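/- **Setting.** Let $q_0>0$, $q_\pm\in\mathbb C$ with $|q_\pm|=q_0$, and let $q(x,t)$ be a classical solution on $\mathbb R\times\mathbb R$ ($q,q_x,q_{xx},q_t$ exist and are continuous) of $$ i q_t+\tfrac12 q_{xx}+(|q|^2-q_0^2)\,q=0, $$ such that $q\to q_\pm$ and $q_x\to0$ as $x\to\pm\infty$, locally uniformly in $t$, and $q(\cdot,t)-q_\pm\in L^1(\mathbb R^\pm)$ for every $t$. (This is the gauge-reduced form of the focusing Kundu–Eckhaus equation with non-zero boundary conditions.) Put $k(z)=\frac12(z-q_0^2/z)$, $\lambda(z)=\frac12(z+q_0^2/z)$, $\theta(x,t;z)=\lambda(z)(x+k(z)t)$, $\gamma(z)=1+q_0^2/z^2$, $D^\pm=\{z\in\mathbb C:\pm(|z|^2-q_0^2)\operatorname{Im}z>0\}$, $\sigma_3=\mathrm{diag}(1,-1)$, $Q=\begin{pmatrix}0&q\\-q^*&0\end{pmatrix}$, $Q_\pm=\begin{pmatrix}0&q_\pm\\-q_\pm^*&0\end{pmatrix}$, $Y_\pm(z)=\mathbb I-\frac iz\sigma_3Q_\pm$, and consider the Lax pair $$\psi_x=(-ik\sigma_3+Q)\psi,\qquad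 \psi_t=\Bigl(-ik^2\sigma_3+kQ+\tfrac i2\sigma_3Q_x-\tfrac i2(Q^2+q_0^2\mathbb I)\sigma_3\Bigr)\psi .$$ The Jost columns $\psi_{\pm,1},\psi_{\pm,2}$ are the simultaneous solutions such that $\psi_{\pm,1}e^{i\theta}$ and $\psi_{\pm,2}e^{-i\theta}$ tend to the first and to the second column of $Y_\pm(z)$ as $x\to\pm\infty$; $\psi_{+,1},\psi_{-,2}$ are used for $z\in D^-$ and $\psi_{-,1},\psi_{+,2}$ for $z\in D^+$. Let $$ s_{11}=\frac{\det(\psi_{+,1},\psi_{-,2})}{\gamma}\ \text{ on } D^-,\qquad s_{22}=\frac{\det(\psi_{-,1},\psi_{+,2})}{\gamma}\ \text{ on } D^+ ,$$ which do not depend on $(x,t)$. A prime denotes $\partial_z$, a star complex conjugation, and a double zero of $s$ is a point with $s=s'=0\ne s''$. **Linear relations.** (i) If $z_n\in D^-$ is a double zero of $s_{11}$, then $s_{11}$ is analytic at $z_n$, $\psi_{+,1}$ and $\psi_{-,2}$ are complex differentiable in $z$ at $z_n$, and there are constants $b_-(z_n)\neq0$ and $d_-(z_n)$, independent of $x,t$,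 such that for all $x,t\in\mathbb R$ $$\psi_{+,1}(x,t;z_n)=b_-(z_n)\psi_{-,2}(x,t;z_n),\qquad \psi_{+,1}'(x,t;z_n)=d_-(z_n)\psi_{-,2}(x,t;z_n)+b_-(z_n)\psi_{-,2}'(x,t;z_n).$$ (ii) If $w\in D^+$ is a double zero of $s_{22}$, then $s_{22}$ is analytic at $w$, $\psi_{+,2}$ and $\psi_{-,1}$ are complex differentiable in $z$ at $w$, and there are constants $b_+(w)\ne0$ and $d_+(w)$, independent of $x,t$, such that for all $x,t\in\mathbb R$ $$\psi_{+,2}(x,t;w)=b_+(w)\psi_{-,1}(x,t;w),\qquad \psi_{+,2}'(x,t;w)=d_+(w)\psi_{-,1}(x,t;w)+b_+(w)\psi_{-,1}'(x,t;w).$$ **Symmetries.** Set $$A_-[z]=\frac{2b_-(z)}{s_{11}''(z)},\quad B_-[z]=\frac{d_-(z)}{b_-(z)}-\frac{s_{11}'''(z)}{3s_{11}''(z)},\quad A_+[w]=\frac{2b_+(w)}{s_{22}''(w)},\quad B_+[w]=\frac{d_+(w)}{b_+(w)}-\frac{s_{22}'''(w)}{3s_{22}''(w)}$$ at the double zeros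 $z\in D^-$ of $s_{11}$ and $w\in D^+$ of $s_{22}$. If $z_n\in D^-$ is a double zero of $s_{11}$, then $z_n^*$ and $-q_0^2/z_n$ lie in $D^+$ and are double zeros of $s_{22}$, $-q_0^2/z_n^*$ lies in $D^-$ and is a double zero of $s_{11}$, and $$A_-[z_n]=-A_+^*[z_n^*]=\frac{z_n^4q_-^*}{q_0^4q_-}A_+\Bigl[-\frac{q_0^2}{z_n}\Bigr]=-\frac{z_n^4q_-^*}{q_0^4q_-}A_-^*\Bigl[-\frac{q_0^2}{z_n^*}\Bigr],$$ $$B_-[z_n]=B_+^*[z_n^*]=\frac{q_0^2}{z_n^2}B_+\Bigl[-\frac{q_0^2}{z_n}\Bigr]+\frac2{z_n}=\frac{q_0^2}{z_n^2}B_-^*\Bigl[-\frac{q_0^2}{z_n^*}\Bigr]+\frac2{z_n}.$$ -/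

import Mathlib

open Filter Topology MeasureTheory Complex
open scoped ComplexConjugate Matrix

namespace KunduEckhaus

/-- A potential `q(x,t)` with non-zero boundary values: a classical solution (`q`, `q_x`, `q_xx`,
`q_t` exist and are jointly continuous) of
`i q_t + (1/2) q_xx + (|q|² - q₀²) q = 0` on `ℝ × ℝ`, which is the compatibility condition of the
Lax pair below, with `q → q_±` and `q_x → 0` as `x → ±∞` locally uniformly in `t`, where
`|q_±| = q₀ > 0`, and with `q(·,t) - q_± ∈ L¹(ℝ^±)`. -/
structure NZBCPotential where
  q₀ : ℝ
  q : ℝ → ℝ → ℂ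
  qMinus : ℂ
  qPlus : ℂ
  q₀_pos : 0 < q₀
  norm_qMinus : ‖qMinus‖ = q₀
  norm_qPlus : ‖qPlus‖ = q₀
  diff_t : ∀ x t : ℝ, DifferentiableAt ℝ (fun s => q x s) t
  diff_x : ∀ x t : ℝ, DifferentiableAt ℝ (fun y => q y t) x
  diff_xx : ∀ x t : ℝ, DifferentiableAt ℝ (deriv (fun y => q y t)) x
  cont_t : Continuous (fun p : ℝ × ℝ => deriv (fun s => q p.1 s) p.2)
  cont_x : Continuous (fun p : ℝ × ℝ => deriv (fun y => q y p.2) p.1)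
  cont_xx : Continuous (fun p : ℝ × ℝ => deriv (deriv (fun y => q y p.2)) p.1)
  equation : ∀ x t : ℝ,
    I * deriv (fun s => q x s) t + (1 / 2) * deriv (deriv (fun y => q y t)) x
      + ((‖q x t‖ : ℂ) ^ 2 - (q₀ : ℂ) ^ 2) * q x t = 0
  tendsto_plus : ∀ t : ℝ, Tendsto (fun p : ℝ × ℝ => q p.1 p.2) (atTop ×ˢ 𝓝 t) (𝓝 qPlus)
  tendsto_minus : ∀ t : ℝ, Tendsto (fun p : ℝ × ℝ => q p.1 p.2) (atBot ×ˢ 𝓝 t) (𝓝 qMinus)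
  tendsto_x_plus : ∀ t : ℝ,
    Tendsto (fun p : ℝ × ℝ => deriv (fun y => q y p.2) p.1) (atTop ×ˢ 𝓝 t) (𝓝 0)
  tendsto_x_minus : ∀ t : ℝ,
    Tendsto (fun p : ℝ × ℝ => deriv (fun y => q y p.2) p.1) (atBot ×ˢ 𝓝 t) (𝓝 0)
  integrable_plus : ∀ t : ℝ, IntegrableOn (fun x => q x t - qPlus) (Set.Ici 0)
  integrable_minus : ∀ t : ℝ, IntegrableOn (fun x => q x t - qMinus) (Set.Iic 0)

namespace NZBCPotential

noncomputable section

/-- `k(z) = (z - q₀²/z)/2`. -/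
def k (P : NZBCPotential) (z : ℂ) : ℂ := (z - (P.q₀ : ℂ) ^ 2 / z) / 2

/-- `λ(z) = (z + q₀²/z)/2`. -/
def lam (P : NZBCPotential) (z : ℂ) : ℂ := (z + (P.q₀ : ℂ) ^ 2 / z) / 2

/-- `θ(x,t;z) = λ(z) (x + k(z) t)`. -/
def theta (P : NZBCPotential) (x t : ℝ) (z : ℂ) : ℂ := P.lam z * ((x : ℂ) + P.k z * (t : ℂ))

/-- `γ(z) = 1 + q₀²/z²`. -/
def gam (P : NZBCPotential) (z : ℂ) : ℂ := 1 + (P.q₀ : ℂ) ^ 2 / z ^ 2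

/-- The region `Im λ > 0`. -/
def DPlus (P : NZBCPotential) : Set ℂ := {z | 0 < (‖z‖ ^ 2 - P.q₀ ^ 2) * z.im}

/-- The region `Im λ < 0`. -/
def DMinus (P : NZBCPotential) : Set ℂ := {z | (‖z‖ ^ 2 - P.q₀ ^ 2) * z.im < 0}

def sigma3 : Matrix (Fin 2) (Fin 2) ℂ := !![1, 0; 0, -1]

/-- The off-diagonal matrix with entries `a` and `-a*`. -/
def offDiag (a : ℂ) : Matrix (Fin 2) (Fin 2) ℂ := !![0, a; -conj a, 0]

/-- `X = -i k σ₃ + Q`. -/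
def laxX (P : NZBCPotential) (x t : ℝ) (z : ℂ) : Matrix (Fin 2) (Fin 2) ℂ :=
  -(I * P.k z) • sigma3 + offDiag (P.q x t)

/-- `T = -i k² σ₃ + k Q + (i/2) σ₃ Q_x - (i/2) (Q² + q₀²) σ₃`. -/
def laxT (P : NZBCPotential) (x t : ℝ) (z : ℂ) : Matrix (Fin 2) (Fin 2) ℂ :=
  -(I * P.k z ^ 2) • sigma3 + P.k z • offDiag (P.q x t)
    + (I / 2) • (sigma3 * offDiag (deriv (fun y => P.q y t) x))
    - (I / 2) • ((offDiag (P.q x t) * offDiag (P.q x t)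
        + ((P.q₀ : ℂ) ^ 2) • (1 : Matrix (Fin 2) (Fin 2) ℂ)) * sigma3)

/-- The eigenvector matrix `Y = I - (i/z) σ₃ Q_∞` for the boundary value `a`. -/
def Y (a z : ℂ) : Matrix (Fin 2) (Fin 2) ℂ := !![1, -(I * a / z); -(I * conj a / z), 1]

/-- The exponent of the `j`-th diagonal entry of `e^{iθσ₃}`. -/
def phase (P : NZBCPotential) (j : Fin 2) (x t : ℝ) (z : ℂ) : ℂ :=
  if j = 0 then I * P.theta x t z else -(I * P.theta x t z)

/-- `ψ` is a `j`-th Jost column at `z`, normalised at the end `l` of the line where `q → a`: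
a simultaneous solution of `ψ_x = X ψ` and `ψ_t = T ψ` such that the `j`-th column
`ψ e^{± iθ}` of `ψ e^{iθσ₃}` tends to the `j`-th column of `Y` along `l`. -/
def IsJostColumn (P : NZBCPotential) (l : Filter ℝ) (a : ℂ) (j : Fin 2) (z : ℂ)
    (ψ : ℝ → ℝ → Fin 2 → ℂ) : Prop :=
  (∀ x t : ℝ, HasDerivAt (fun y => ψ y t) (P.laxX x t z *ᵥ ψ x t) x) ∧
  (∀ x t : ℝ, HasDerivAt (fun s => ψ x s) (P.laxT x t z *ᵥ ψ x t) t) ∧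
  (∀ t : ℝ, Tendsto (fun x => exp (P.phase j x t z) • ψ x t) l (𝓝 (fun i => Y a z i j)))

/-- The columns `ψ_{+,1}` (`j = 0`) and `ψ_{+,2}` (`j = 1`). The Jost column exists and is unique
for `z` in `D⁻` if `j = 0` and in `D⁺` if `j = 1`; it is only used there. -/
def psiPlus (P : NZBCPotential) (j : Fin 2) (x t : ℝ) (z : ℂ) : Fin 2 → ℂ :=
  Classical.epsilon (P.IsJostColumn atTop P.qPlus j z) x t

/-- The columns `ψ_{-,1}` (`j = 0`) and `ψ_{-,2}` (`j = 1`). The Jost column exists and is unique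
for `z` in `D⁺` if `j = 0` and in `D⁻` if `j = 1`; it is only used there. -/
def psiMinus (P : NZBCPotential) (j : Fin 2) (x t : ℝ) (z : ℂ) : Fin 2 → ℂ :=
  Classical.epsilon (P.IsJostColumn atBot P.qMinus j z) x t

/-- The determinant of the matrix with columns `u`, `v`. -/
def Wr (u v : Fin 2 → ℂ) : ℂ := u 0 * v 1 - u 1 * v 0

/-- `s₁₁ = Wr(ψ_{+,1}, ψ_{-,2}) / γ` on `D⁻`. The Wronskian does not depend on `(x,t)`, because
`X` and `T` are trace-free, so it is taken at `(0,0)`. -/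
def s11 (P : NZBCPotential) (z : ℂ) : ℂ :=
  Wr (P.psiPlus 0 0 0 z) (P.psiMinus 1 0 0 z) / P.gam z

/-- `s₂₂ = Wr(ψ_{-,1}, ψ_{+,2}) / γ` on `D⁺`. -/
def s22 (P : NZBCPotential) (z : ℂ) : ℂ :=
  Wr (P.psiMinus 0 0 0 z) (P.psiPlus 1 0 0 z) / P.gam z

/-- `f(z) = f'(z) = 0` and `f''(z) ≠ 0`. -/
def IsDoubleZero (f : ℂ → ℂ) (z : ℂ) : Prop :=
  f z = 0 ∧ deriv f z = 0 ∧ iteratedDeriv 2 f z ≠ 0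

/-- The derivative in `z` of the columns of `ψ_+`. -/
def psiPlus' (P : NZBCPotential) (j : Fin 2) (x t : ℝ) (z : ℂ) : Fin 2 → ℂ :=
  deriv (fun w => P.psiPlus j x t w) z

/-- The derivative in `z` of the columns of `ψ_-`. -/
def psiMinus' (P : NZBCPotential) (j : Fin 2) (x t : ℝ) (z : ℂ) : Fin 2 → ℂ :=
  deriv (fun w => P.psiMinus j x t w) z

/-- The constant `b_-(z)`, independent of `(x,t)`, with `ψ_{+,1} = b_- ψ_{-,2}` at `z`. -/
def bMinus (P : NZBCPotential) (z : ℂ) : ℂ :=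
  Classical.epsilon fun b : ℂ => ∀ x t : ℝ, P.psiPlus 0 x t z = b • P.psiMinus 1 x t z

/-- The constant `d_-(z)`, independent of `(x,t)`, with
`ψ'_{+,1} = d_- ψ_{-,2} + b_- ψ'_{-,2}` at `z`. -/
def dMinus (P : NZBCPotential) (z : ℂ) : ℂ :=
  Classical.epsilon fun d : ℂ => ∀ x t : ℝ,
    P.psiPlus' 0 x t z = d • P.psiMinus 1 x t z + P.bMinus z • P.psiMinus' 1 x t z

/-- The constant `b_+(z)`, independent of `(x,t)`, with `ψ_{+,2} = b_+ ψ_{-,1}` at `z`. -/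
def bPlus (P : NZBCPotential) (z : ℂ) : ℂ :=
  Classical.epsilon fun b : ℂ => ∀ x t : ℝ, P.psiPlus 1 x t z = b • P.psiMinus 0 x t z

/-- The constant `d_+(z)`, independent of `(x,t)`, with
`ψ'_{+,2} = d_+ ψ_{-,1} + b_+ ψ'_{-,1}` at `z`. -/
def dPlus (P : NZBCPotential) (z : ℂ) : ℂ :=
  Classical.epsilon fun d : ℂ => ∀ x t : ℝ,
    P.psiPlus' 1 x t z = d • P.psiMinus 0 x t z + P.bPlus z • P.psiMinus' 0 x t z

/-- `A_-[z] = 2 b_-(z) / s₁₁''(z)`. -/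
def AMinus (P : NZBCPotential) (z : ℂ) : ℂ := 2 * P.bMinus z / iteratedDeriv 2 P.s11 z

/-- `B_-[z] = d_-(z)/b_-(z) - s₁₁'''(z) / (3 s₁₁''(z))`. -/
def BMinus (P : NZBCPotential) (z : ℂ) : ℂ :=
  P.dMinus z / P.bMinus z - iteratedDeriv 3 P.s11 z / (3 * iteratedDeriv 2 P.s11 z)

/-- `A_+[z] = 2 b_+(z) / s₂₂''(z)`. -/
def APlus (P : NZBCPotential) (z : ℂ) : ℂ := 2 * P.bPlus z / iteratedDeriv 2 P.s22 z

/-- `B_+[z] = d_+(z)/b_+(z) - s₂₂'''(z) / (3 s₂₂''(z))`. -/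
def BPlus (P : NZBCPotential) (z : ℂ) : ℂ :=
  P.dPlus z / P.bPlus z - iteratedDeriv 3 P.s22 z / (3 * iteratedDeriv 2 P.s22 z)

end

end NZBCPotential

end KunduEckhaus

/-! The only inputs are the linear Lax system and its behaviour at the two ends of the line.

Jost columns. With `t = 0` and `χ = e^{iλx} ψ`, the `x`-equation becomes `χ' = (M(z) + W(x)) χ`,
where `M` is the limit at `+∞` and `W` is integrable. Since `M² = 2iλ M` and `Re 2iλ > 0` on `D⁻`,
the propagator `e^{sM}` is bounded for `s ≤ 0`. Hence there is exactly one solution tending to the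
null vector of `M`, and as a locally uniform limit of holomorphic approximations it is holomorphic
in `z` (`exists_solution_tendsto`, `eq_zero_of_tendsto_zero`). Compatibility of the Lax pair extends
it to all `t`, and `IsSol.tendsto_of_tendsto_zero` extends its normalisation. This treats `ψ_{+,1}`.
The reflection `x ↦ -x`, `z ↦ -z` yields `ψ_{-,1}`, and the involution `z ↦ -q₀²/z` yields the two
second columns.

Linear relations. A zero of the Wronskian makes the two columns proportional with factor `b`. Its
vanishing derivative gives a `d` for which `φ - (b + d (z - z₀)) ψ` vanishes to second order at one
point `(x, t)`. This is a family of solutions of a linear system, so it vanishes to second order at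
every `(x, t)` (`exists_linear_relations`).

Symmetries. Uniqueness of Jost columns turns each symmetry of the Lax pair into an identity between
columns: `v ↦ (-v₂*, v₁*)` relates `z` to `z*`, and scalar multiplication relates `z` to `-q₀²/z`,
because the Lax pair depends on `z` only through `k`. Differentiating these identities gives the
rules for `s₁₁`, `b`, `d`, and hence for `A` and `B`; the term `2/z` is `-g''/g'` for `g(z) =
-q₀²/z`. The third equality of each chain composes the two symmetries. -/

namespace LinearODE

/-! ### Linear ODEs in a Banach space: existence, uniqueness, dependence on parameters, compatible
pairs. -/

theorem exists_bound {F : Type*} [SeminormedAddCommGroup F] {A : ℝ → F} (s₀ : ℝ) (hA : Continuous A) (R : ℝ) :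
    ∃ C, 0 ≤ C ∧ ∀ s, |s - s₀| ≤ R → ‖A s‖ ≤ C := by
  obtain ⟨C, hC⟩ := (isCompact_closedBall s₀ R).exists_bound_of_continuousOn hA.continuousOn
  refine ⟨max C 0, le_max_right _ _, fun s hs => (hC s ?_).trans (le_max_left _ _)⟩
  simpa [Real.dist_eq] using hs

/-- Both Lax matrices are polynomials in `k(z)` of degree at most two, hence of the form `A₀ + f(z)
A₁ + g(z) A₂`. First-order expansion of `f` and `g` then gives a remainder uniform for `s` in a
compact interval, which is what a Grönwall argument needs. -/
theorem eventually_norm_coeff_sub_le {E : Type*} [NormedAddCommGroup E] [NormedSpace ℂ E]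
    (A₀ : ℝ → E →L[ℂ] E) {A₁ A₂ : ℝ → E →L[ℂ] E} {f g : ℂ → ℂ} {z₀ : ℂ} (s₀ : ℝ)
    (h₁ : Continuous A₁) (h₂ : Continuous A₂)
    (hf : DifferentiableAt ℂ f z₀) (hg : DifferentiableAt ℂ g z₀) (R ε : ℝ) (hε : 0 < ε) :
    ∀ᶠ z in 𝓝 z₀, ∀ s, |s - s₀| ≤ R →
      ‖A₀ s + f z • A₁ s + g z • A₂ s - (A₀ s + f z₀ • A₁ s + g z₀ • A₂ s)
        - (z - z₀) • (deriv f z₀ • A₁ s + deriv g z₀ • A₂ s)‖ ≤ ε * ‖z - z₀‖ := by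
  obtain ⟨C₁, hC₁, hb₁⟩ := exists_bound s₀ h₁ R
  obtain ⟨C₂, hC₂, hb₂⟩ := exists_bound s₀ h₂ R
  have hf' := hasDerivAt_iff_isLittleO.1 hf.hasDerivAt
  have hg' := hasDerivAt_iff_isLittleO.1 hg.hasDerivAt
  rw [Asymptotics.isLittleO_iff] at hf' hg'
  have hε' : 0 < ε / (C₁ + C₂ + 1) := by positivity
  filter_upwards [hf' hε', hg' hε'] with z hfz hgz s hs
  have e : A₀ s + f z • A₁ s + g z • A₂ s - (A₀ s + f z₀ • A₁ s + g z₀ • A₂ s)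
      - (z - z₀) • (deriv f z₀ • A₁ s + deriv g z₀ • A₂ s)
      = (f z - f z₀ - (z - z₀) • deriv f z₀) • A₁ s
        + (g z - g z₀ - (z - z₀) • deriv g z₀) • A₂ s := by
    simp only [smul_eq_mul]; module
  rw [e]
  calc _ ≤ ‖f z - f z₀ - (z - z₀) • deriv f z₀‖ * ‖A₁ s‖
        + ‖g z - g z₀ - (z - z₀) • deriv g z₀‖ * ‖A₂ s‖ := by
        refine (norm_add_le _ _).trans ?_
        rw [norm_smul, norm_smul]
    _ ≤ (ε / (C₁ + C₂ + 1) * ‖z - z₀‖) * C₁ + (ε / (C₁ + C₂ + 1) * ‖z - z₀‖) * C₂ := by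
        gcongr
        exacts [hb₁ s hs, hb₂ s hs]
    _ ≤ (ε / (C₁ + C₂ + 1) * ‖z - z₀‖) * (C₁ + C₂ + 1) := by
        have : 0 ≤ ε / (C₁ + C₂ + 1) * ‖z - z₀‖ := by positivity
        nlinarith
    _ = _ := by field_simp

variable {E : Type*} [NormedAddCommGroup E] [NormedSpace ℝ E]

/-- A two-sided Grönwall inequality around the base point `s₀`. -/
theorem norm_le_of_norm_deriv_le {f f' : ℝ → E} {s₀ R C δ ε : ℝ} (hC : 0 ≤ C) (hδ : 0 ≤ δ)
    (hε : 0 ≤ ε) (hf : ∀ s, |s - s₀| ≤ R → HasDerivAt f (f' s) s)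
    (hb : ∀ s, |s - s₀| ≤ R → ‖f' s‖ ≤ C * ‖f s‖ + ε) (h0 : ‖f s₀‖ ≤ δ) {s : ℝ}
    (hs : |s - s₀| ≤ R) : ‖f s‖ ≤ (δ + ε) * Real.exp ((C + 1) * R) := by
  have hR : 0 ≤ R := (abs_nonneg _).trans hs
  have key : ∀ x, 0 ≤ x → x ≤ R →
      gronwallBound δ (C + 1) ε x ≤ (δ + ε) * Real.exp ((C + 1) * R) := by
    intro x hx hxR
    -- The rate is `C + 1` rather than `C` so that it is nonzero and the closed form of the Grönwall
    -- bound applies.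
    rw [gronwallBound_of_K_ne_0 (by positivity)]
    have h1 : Real.exp ((C + 1) * x) ≤ Real.exp ((C + 1) * R) := by gcongr
    have h2 : ε / (C + 1) ≤ ε := div_le_self hε (by linarith)
    have h3 : 0 ≤ ε / (C + 1) := by positivity
    have h4 : 0 < Real.exp ((C + 1) * x) := Real.exp_pos _
    have h5 : 0 < Real.exp ((C + 1) * R) := Real.exp_pos _
    calc δ * Real.exp ((C + 1) * x) + ε / (C + 1) * (Real.exp ((C + 1) * x) - 1)
        ≤ δ * Real.exp ((C + 1) * R) + ε / (C + 1) * Real.exp ((C + 1) * R) := by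
          gcongr; linarith
      _ ≤ δ * Real.exp ((C + 1) * R) + ε * Real.exp ((C + 1) * R) := by gcongr
      _ = _ := by ring
  rcases le_total s₀ s with h | h
  · have := norm_le_gronwallBound_of_norm_deriv_right_le (f := f) (f' := f') (δ := δ) (K := C + 1)
      (ε := ε) (a := s₀) (b := s₀ + R)
      (fun x hx => (hf x (by rw [abs_le]; constructor <;> linarith [hx.1, hx.2])).continuousAt.continuousWithinAt)
      (fun x hx => (hf x (by rw [abs_le]; constructor <;> linarith [hx.1, hx.2])).hasDerivWithinAt) h0
      (fun x hx => (hb x (by rw [abs_le]; constructor <;> linarith [hx.1, hx.2])).trans (by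
        have := norm_nonneg (f x); nlinarith)) s ⟨h, by have := (abs_le.1 hs).2; linarith⟩
    exact this.trans (key _ (by linarith) ((le_abs_self _).trans hs))
  -- To the left of `s₀` the one-sided inequality is applied to the time-reversed function `y ↦ f
  -- (s₀ - y)`.
  · have hA : ∀ x ∈ Set.Icc (0 : ℝ) R, |(s₀ - x) - s₀| ≤ R := by
      intro x hx
      rw [abs_le]; constructor <;> linarith [hx.1, hx.2]
    have hd : ∀ x ∈ Set.Icc (0 : ℝ) R,
        HasDerivAt (fun y => f (s₀ - y)) (-(f' (s₀ - x))) x := by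
      intro x hx
      have := (hf (s₀ - x) (hA x hx)).scomp x ((hasDerivAt_id x).const_sub s₀)
      simpa [Function.comp_def] using this
    have := norm_le_gronwallBound_of_norm_deriv_right_le (f := fun y => f (s₀ - y))
      (f' := fun y => -(f' (s₀ - y))) (δ := δ) (K := C + 1)
      (ε := ε) (a := 0) (b := R)
      (fun x hx => (hd x hx).continuousAt.continuousWithinAt)
      (fun x hx => (hd x ⟨hx.1, hx.2.le⟩).hasDerivWithinAt) (by simpa using h0)
      (fun x hx => by
        rw [norm_neg]
        refine (hb _ (hA x ⟨hx.1, hx.2.le⟩)).trans ?_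
        have := norm_nonneg (f (s₀ - x)); nlinarith) (s₀ - s)
        ⟨by linarith, by have := (abs_le.1 hs).1; linarith⟩
    have h2 := this.trans (key _ (by linarith) (by have := (abs_le.1 hs).1; linarith))
    simpa using h2

/-- Rescaling to the unit interval treats `t` on either side of `s₀` at once. The denominator `n +
1` builds up the factorials in the Picard series. -/
theorem norm_integral_le_of_norm_le_pow {f : ℝ → E} {K t s₀ : ℝ} {n : ℕ}
    (hf : ∀ s, |s - s₀| ≤ |t - s₀| → ‖f s‖ ≤ K * |s - s₀| ^ n) :
    ‖∫ s in s₀..t, f s‖ ≤ K * |t - s₀| ^ (n + 1) / (n + 1) := by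
  set r := t - s₀ with hr
  have h1 : ∫ s in s₀..t, f s = r • ∫ u in (0 : ℝ)..1, f (s₀ + r * u) := by
    have := intervalIntegral.smul_integral_comp_add_mul (a := 0) (b := 1) f r s₀
    rw [this]; simp [hr]
  have h2 : ‖∫ u in (0 : ℝ)..1, f (s₀ + r * u)‖ ≤ ∫ u in (0 : ℝ)..1, K * |r| ^ n * u ^ n := by
    refine intervalIntegral.norm_integral_le_of_norm_le zero_le_one
      (Eventually.of_forall fun u hu => ?_) (Continuous.intervalIntegrable (by fun_prop) _ _)
    have hu0 : 0 ≤ u := hu.1.le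
    have e : |s₀ + r * u - s₀| = |r| * u := by
      rw [add_sub_cancel_left, abs_mul, abs_of_nonneg hu0]
    refine (hf _ ?_).trans (le_of_eq ?_)
    · rw [e]; exact mul_le_of_le_one_right (abs_nonneg _) hu.2
    · rw [e]; ring
  rw [h1, norm_smul, Real.norm_eq_abs]
  rw [intervalIntegral.integral_const_mul, integral_pow] at h2
  calc |r| * ‖∫ u in (0 : ℝ)..1, f (s₀ + r * u)‖
      ≤ |r| * (K * |r| ^ n * ((1 ^ (n + 1) - 0 ^ (n + 1)) / (n + 1))) := by gcongr
    _ = _ := by simp; ring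

variable {𝕜 : Type*} [RCLike 𝕜] [NormedSpace 𝕜 E]

section Existence

variable (A : ℝ → E →L[𝕜] E) (s₀ : ℝ) (v : E)

/-- The terms of the Picard series of `y' = A y`, `y(s₀) = v`. -/
noncomputable def picardTerm : ℕ → ℝ → E
  | 0 => fun _ => v
  | n + 1 => fun t => ∫ s in s₀..t, A s (picardTerm n s)

variable {A}

theorem continuous_picardTerm (hA : Continuous A) (n : ℕ) : Continuous (picardTerm A s₀ v n) := by
  induction n with
  | zero => exact continuous_const
  | succ n ih =>
    refine intervalIntegral.continuous_primitive (fun a b => ?_) s₀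
    exact (hA.clm_apply ih).intervalIntegrable _ _

theorem hasDerivAt_picardTerm [CompleteSpace E] (hA : Continuous A) (n : ℕ) (t : ℝ) :
    HasDerivAt (picardTerm A s₀ v (n + 1)) (A t (picardTerm A s₀ v n t)) t :=
  ((hA.clm_apply (continuous_picardTerm s₀ v hA n))).integral_hasStrictDerivAt s₀ t |>.hasDerivAt

theorem norm_picardTerm_le {C R : ℝ} (hC : 0 ≤ C) (hAC : ∀ s, |s - s₀| ≤ R → ‖A s‖ ≤ C)
    (n : ℕ) {t : ℝ} (ht : |t - s₀| ≤ R) :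
    ‖picardTerm A s₀ v n t‖ ≤ ‖v‖ * C ^ n / n.factorial * |t - s₀| ^ n := by
  induction n generalizing t with
  | zero => simp [picardTerm]
  | succ n ih =>
    have := norm_integral_le_of_norm_le_pow (f := fun s => A s (picardTerm A s₀ v n s)) (s₀ := s₀)
      (K := C * (‖v‖ * C ^ n / n.factorial)) (t := t) (n := n) (fun s hs => by
        refine ((A s).le_opNorm _).trans ?_
        rw [mul_assoc]
        exact mul_le_mul (hAC s (hs.trans ht)) (ih (hs.trans ht)) (norm_nonneg _) hC)
    refine this.trans (le_of_eq ?_)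
    rw [Nat.factorial_succ]
    push_cast
    field_simp
    ring

theorem exists_solution [CompleteSpace E] (hA : Continuous A) :
    ∃ y : ℝ → E, y s₀ = v ∧ ∀ s, HasDerivAt y (A s (y s)) s := by
  have zero_at : ∀ n, picardTerm A s₀ v (n + 1) s₀ = 0 := fun n => by simp [picardTerm]
  refine ⟨fun t => v + ∑' n, picardTerm A s₀ v (n + 1) t, by simp [zero_at], fun s => ?_⟩
  -- The extra `1` places `s` inside an open ball on which the differentiated series converges
  -- uniformly, so termwise differentiation is allowed.
  obtain ⟨C, hC, hAC⟩ := exists_bound s₀ hA (|s - s₀| + 1)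
  set R := |s - s₀| + 1
  have hR : 0 ≤ R := by positivity
  have bound : ∀ n t, |t - s₀| ≤ R → ‖picardTerm A s₀ v n t‖ ≤ ‖v‖ * ((C * R) ^ n / n.factorial) := by
    intro n t ht
    refine (norm_picardTerm_le s₀ v hC hAC n ht).trans ?_
    calc _ ≤ ‖v‖ * C ^ n / n.factorial * R ^ n := by gcongr
      _ = _ := by rw [mul_pow]; ring
  have hsum : Summable fun n : ℕ => ‖v‖ * ((C * R) ^ n / n.factorial) :=
    (Real.summable_pow_div_factorial _).mul_left _
  have hs : |s - s₀| ≤ R := by simp [R]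
  have hd := hasDerivAt_tsum_of_isPreconnected (u := fun n : ℕ => C * (‖v‖ * ((C * R) ^ n / n.factorial)))
    (g := fun n => picardTerm A s₀ v (n + 1)) (g' := fun n t => A t (picardTerm A s₀ v n t))
    (t := Metric.ball s₀ R) (y := s) (y₀ := s₀) (hsum.mul_left C) Metric.isOpen_ball
    (convex_ball s₀ R).isPreconnected
    (fun n t _ => hasDerivAt_picardTerm s₀ v hA n t)
    (fun n t ht => by
      have ht' : |t - s₀| ≤ R := by
        rw [Metric.mem_ball, Real.dist_eq] at ht; exact ht.le
      refine ((A t).le_opNorm _).trans ?_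
      exact mul_le_mul (hAC t ht') (bound n t ht') (norm_nonneg _) hC)
    (Metric.mem_ball_self (by positivity)) (by simp [zero_at, summable_zero])
    (by rw [Metric.mem_ball, Real.dist_eq]; simp [R])
  have hsm : Summable fun n => picardTerm A s₀ v n s :=
    Summable.of_norm_bounded hsum fun n => bound n s hs
  have e : A s (v + ∑' n, picardTerm A s₀ v (n + 1) s) = ∑' n, A s (picardTerm A s₀ v n s) := by
    rw [← (A s).map_tsum hsm, hsm.tsum_eq_zero_add]; rfl
  rw [e]
  exact hd.const_add v

variable {s₀} {v}

theorem norm_solution_le {y : ℝ → E} {C R : ℝ} (hC : 0 ≤ C)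
    (hAC : ∀ s, |s - s₀| ≤ R → ‖A s‖ ≤ C) (hy : ∀ s, HasDerivAt y (A s (y s)) s) {s : ℝ}
    (hs : |s - s₀| ≤ R) : ‖y s‖ ≤ ‖y s₀‖ * Real.exp ((C + 1) * R) := by
  have := norm_le_of_norm_deriv_le (f := y) (f' := fun s => A s (y s)) (s₀ := s₀) (R := R)
    (C := C) (δ := ‖y s₀‖) (ε := 0) hC (norm_nonneg _) le_rfl (fun s _ => hy s)
    (fun s hs => by
      rw [add_zero]
      exact ((A s).le_opNorm _).trans (by gcongr; exact hAC s hs)) le_rfl hs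
  simpa using this

theorem solution_unique (hA : Continuous A) {y w : ℝ → E}
    (hy : ∀ s, HasDerivAt y (A s (y s)) s) (hw : ∀ s, HasDerivAt w (A s (w s)) s)
    (h : y s₀ = w s₀) : y = w := by
  funext s
  obtain ⟨C, hC, hAC⟩ := exists_bound s₀ hA |s - s₀|
  have := norm_solution_le (y := fun s => y s - w s) hC hAC
    (fun s => by simpa using! (hy s).sub (hw s)) le_rfl
  simpa [h, sub_eq_zero] using this

end Existence

/-- Differentiability in the parameter of solutions of a linear equation, when a solution of the
variational equation is known. -/
theorem hasDerivAt_param [SMulCommClass ℝ 𝕜 E]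
    {A : 𝕜 → ℝ → E →L[𝕜] E} {B : ℝ → E →L[𝕜] E} {z₀ : 𝕜} {s₀ R : ℝ}
    (hA : Continuous (A z₀)) (hB : Continuous B)
    (hrem : ∀ ε : ℝ, 0 < ε → ∀ᶠ z in 𝓝 z₀, ∀ s, |s - s₀| ≤ R →
      ‖A z s - A z₀ s - (z - z₀) • B s‖ ≤ ε * ‖z - z₀‖)
    {y : 𝕜 → ℝ → E} (hy : ∀ᶠ z in 𝓝 z₀, ∀ s, HasDerivAt (y z) (A z s (y z s)) s)
    {χ : ℝ → E} (hχ : ∀ s, HasDerivAt χ (B s (y z₀ s) + A z₀ s (χ s)) s)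
    (h0 : HasDerivAt (fun z => y z s₀) (χ s₀) z₀) {s : ℝ} (hs : |s - s₀| ≤ R) :
    HasDerivAt (fun z => y z s) (χ s) z₀ := by
  have hR : 0 ≤ R := (abs_nonneg _).trans hs
  obtain ⟨C, hC, hAC⟩ := exists_bound s₀ hA R
  obtain ⟨CB, hCB, hBC⟩ := exists_bound s₀ hB R
  have hyc : Continuous (y z₀) := continuous_iff_continuousAt.2 fun s => (hy.self_of_nhds s).continuousAt
  have hχc : Continuous χ := continuous_iff_continuousAt.2 fun s => (hχ s).continuousAt
  obtain ⟨Cy, hCy⟩ := (isCompact_closedBall s₀ R).exists_bound_of_continuousOn hyc.continuousOn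
  obtain ⟨Cχ, hCχ⟩ := (isCompact_closedBall s₀ R).exists_bound_of_continuousOn hχc.continuousOn
  have hCy0 : 0 ≤ Cy := (norm_nonneg _).trans (hCy s₀ (Metric.mem_closedBall_self hR))
  have hCχ0 : 0 ≤ Cχ := (norm_nonneg _).trans (hCχ s₀ (Metric.mem_closedBall_self hR))
  have hK : 0 < (1 + Cy + 2 * Cχ) * Real.exp ((C + CB + 1 + 1) * R) := by positivity
  rw [hasDerivAt_iff_isLittleO]
  rw [Asymptotics.isLittleO_iff]
  intro c hc
  -- The final estimate is `ε` times this denominator times `‖z - z₀‖`; the cap at `1` keeps `‖A z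
  -- s‖` below `C + CB + 1`.
  set ε := min 1 (c / ((1 + Cy + 2 * Cχ) * Real.exp ((C + CB + 1 + 1) * R)))
  have hε : 0 < ε := lt_min one_pos (by positivity)
  have h0' := (hasDerivAt_iff_isLittleO.1 h0)
  rw [Asymptotics.isLittleO_iff] at h0'
  have hball : ∀ᶠ z in 𝓝 z₀, ‖z - z₀‖ ≤ ε / (CB + 1) := by
    filter_upwards [Metric.closedBall_mem_nhds z₀ (show 0 < ε / (CB + 1) by positivity)] with z hz
    simpa [dist_eq_norm] using hz
  filter_upwards [hrem ε hε, hy, h0' hε, hball] with z hz hyz h0z hbz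
  set h := z - z₀
  have hCBh : CB * ‖h‖ ≤ ε := by
    calc CB * ‖h‖ ≤ (CB + 1) * (ε / (CB + 1)) := by gcongr; linarith
      _ = ε := by field_simp
  have hh1 : ‖h‖ ≤ 1 := hbz.trans (by
    rw [div_le_one (by positivity)]
    exact (min_le_left _ _).trans (by linarith))
  have hε1 : ε ≤ 1 := min_le_left _ _
  have hdiff : ∀ s, |s - s₀| ≤ R → ‖A z s - A z₀ s‖ ≤ ε * ‖h‖ + CB * ‖h‖ := fun s hs => by
    calc ‖A z s - A z₀ s‖ = ‖(A z s - A z₀ s - h • B s) + h • B s‖ := by congr 1; abel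
      _ ≤ ‖A z s - A z₀ s - h • B s‖ + ‖h • B s‖ := norm_add_le _ _
      _ ≤ _ := by
        rw [norm_smul, mul_comm CB]
        gcongr
        · exact hz s hs
        · exact hBC s hs
  have hAz : ∀ s, |s - s₀| ≤ R → ‖A z s‖ ≤ C + CB + 1 := fun s hs => by
    calc ‖A z s‖ = ‖A z₀ s + (A z s - A z₀ s)‖ := by congr 1; abel
      _ ≤ ‖A z₀ s‖ + ‖A z s - A z₀ s‖ := norm_add_le _ _
      _ ≤ C + (ε * ‖h‖ + CB * ‖h‖) := add_le_add (hAC s hs) (hdiff s hs)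
      _ ≤ C + (1 * 1 + CB * 1) := by gcongr
      _ = _ := by ring
  -- The linearisation error solves the equation of `A z` with a source of size `ε ‖h‖`, so Grönwall
  -- bounds it by a multiple of `ε ‖h‖`.
  have main := norm_le_of_norm_deriv_le (f := fun s => y z s - y z₀ s - h • χ s)
    (f' := fun s => A z s (y z s) - A z₀ s (y z₀ s) - h • (B s (y z₀ s) + A z₀ s (χ s)))
    (s₀ := s₀) (R := R) (C := C + CB + 1) (δ := ε * ‖h‖) (ε := ε * ‖h‖ * (Cy + 2 * Cχ))
    (by positivity) (by positivity) (by positivity)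
    (fun s _ => ((hyz s).sub (hy.self_of_nhds s)).sub ((hχ s).const_smul h))
    (fun s hs => by
      have hsm : s ∈ Metric.closedBall s₀ R := by simpa [Real.dist_eq] using hs
      have e : A z s (y z s) - A z₀ s (y z₀ s) - h • (B s (y z₀ s) + A z₀ s (χ s))
          = A z s (y z s - y z₀ s - h • χ s) + ((A z s - A z₀ s - h • B s) (y z₀ s)
            + h • (A z s - A z₀ s) (χ s)) := by
        simp only [map_sub, map_smul, sub_apply, smul_apply,
          smul_sub, smul_add]
        abel
      rw [e]
      refine (norm_add_le _ _).trans (add_le_add ?_ ?_)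
      · exact ((A z s).le_opNorm _).trans (by gcongr; exact hAz s hs)
      · refine (norm_add_le _ _).trans ?_
        have t1 : ‖(A z s - A z₀ s - h • B s) (y z₀ s)‖ ≤ ε * ‖h‖ * Cy :=
          (ContinuousLinearMap.le_opNorm _ _).trans
            (mul_le_mul (hz s hs) (hCy s hsm) (norm_nonneg _) (by positivity))
        have t2 : ‖h • (A z s - A z₀ s) (χ s)‖ ≤ ‖h‖ * ((ε + ε) * Cχ) := by
          rw [norm_smul]
          gcongr
          refine (ContinuousLinearMap.le_opNorm _ _).trans ?_
          refine mul_le_mul ((hdiff s hs).trans ?_) (hCχ s hsm) (norm_nonneg _) (by positivity)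
          exact add_le_add (mul_le_of_le_one_right hε.le hh1) hCBh
        calc _ ≤ ε * ‖h‖ * Cy + ‖h‖ * ((ε + ε) * Cχ) := add_le_add t1 t2
          _ = _ := by ring)
    h0z hs
  refine main.trans ?_
  have hεc : ε * ((1 + Cy + 2 * Cχ) * Real.exp ((C + CB + 1 + 1) * R)) ≤ c := by
    rw [← le_div_iff₀ hK]; exact min_le_right _ _
  calc _ = ε * ((1 + Cy + 2 * Cχ) * Real.exp ((C + CB + 1 + 1) * R)) * ‖h‖ := by ring
    _ ≤ c * ‖h‖ := by gcongr

/-- Solutions of a linear equation with parameter are differentiable in the parameter. -/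
theorem differentiableAt_param [NormedSpace ℂ E] [SMulCommClass ℝ ℂ E] [CompleteSpace E]
    {A : ℂ → ℝ → E →L[ℂ] E} {B : ℝ → E →L[ℂ] E} {z₀ : ℂ} {s₀ : ℝ}
    (hA : ∀ z, Continuous (A z)) (hB : Continuous B)
    (hrem : ∀ R ε : ℝ, 0 < ε → ∀ᶠ z in 𝓝 z₀, ∀ s, |s - s₀| ≤ R →
      ‖A z s - A z₀ s - (z - z₀) • B s‖ ≤ ε * ‖z - z₀‖)
    {y : ℂ → ℝ → E} (hy : ∀ᶠ z in 𝓝 z₀, ∀ s, HasDerivAt (y z) (A z s (y z s)) s)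
    (h0 : DifferentiableAt ℂ (fun z => y z s₀) z₀) (s : ℝ) :
    DifferentiableAt ℂ (fun z => y z s) z₀ := by
  -- The variational equation is inhomogeneous, but the solution paired with its parameter
  -- derivative satisfies a homogeneous linear equation on `E × E`.
  obtain ⟨w, hw0, hw⟩ := exists_solution (E := E × E)
    (A := fun s => ((A z₀ s).comp (ContinuousLinearMap.fst ℂ E E)).prod
      ((B s).comp (ContinuousLinearMap.fst ℂ E E) + (A z₀ s).comp (ContinuousLinearMap.snd ℂ E E)))
    s₀ (y z₀ s₀, deriv (fun z => y z s₀) z₀) (by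
      have := hA z₀
      have h1 : Continuous fun s => (A z₀ s).comp (ContinuousLinearMap.fst ℂ E E) := by fun_prop
      have h2 : Continuous fun s => ((B s).comp (ContinuousLinearMap.fst ℂ E E)
        + (A z₀ s).comp (ContinuousLinearMap.snd ℂ E E)) := by fun_prop
      exact (ContinuousLinearMap.prodₗᵢ ℂ (E := E × E) (F := E) (G := E) (𝕜 := ℂ)).continuous.comp
        (h1.prodMk h2))
  have hw1 : ∀ s, HasDerivAt (fun s => (w s).1) (A z₀ s (w s).1) s := fun s => by
    simpa using! ((ContinuousLinearMap.fst ℝ E E).hasFDerivAt.comp_hasDerivAt s (hw s))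
  have hw2 : ∀ s, HasDerivAt (fun s => (w s).2) (B s (w s).1 + A z₀ s (w s).2) s := fun s => by
    simpa using! ((ContinuousLinearMap.snd ℝ E E).hasFDerivAt.comp_hasDerivAt s (hw s))
  have hy0 : y z₀ = fun s => (w s).1 :=
    solution_unique (s₀ := s₀) (hA z₀) hy.self_of_nhds hw1 (by simp [hw0])
  refine (hasDerivAt_param (χ := fun s => (w s).2) (hA z₀) hB (hrem |s - s₀|) hy
    (by rw [hy0]; exact hw2) ?_ le_rfl).differentiableAt
  simpa [hw0] using h0.hasDerivAt

/-- Holomorphic dependence when the parameter enters through scalar coefficient functions. -/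
theorem differentiableAt_param_of_coeff [NormedSpace ℂ E] [SMulCommClass ℝ ℂ E] [CompleteSpace E]
    {A₀ A₁ A₂ : ℝ → E →L[ℂ] E} {f g : ℂ → ℂ} {z₀ : ℂ} {s₀ : ℝ}
    (h₀ : Continuous A₀) (h₁ : Continuous A₁) (h₂ : Continuous A₂)
    (hf : DifferentiableAt ℂ f z₀) (hg : DifferentiableAt ℂ g z₀)
    {y : ℂ → ℝ → E}
    (hy : ∀ᶠ z in 𝓝 z₀, ∀ s, HasDerivAt (y z) ((A₀ s + f z • A₁ s + g z • A₂ s) (y z s)) s)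
    (h0 : DifferentiableAt ℂ (fun z => y z s₀) z₀) (s : ℝ) :
    DifferentiableAt ℂ (fun z => y z s) z₀ :=
  differentiableAt_param (A := fun z s => A₀ s + f z • A₁ s + g z • A₂ s)
    (B := fun s => deriv f z₀ • A₁ s + deriv g z₀ • A₂ s) (s₀ := s₀)
    (fun z => by fun_prop) (by fun_prop)
    (eventually_norm_coeff_sub_le A₀ s₀ h₁ h₂ hf hg) hy h0 s

/-- A family of solutions which vanishes to second order in the parameter at one point does so
everywhere. -/
theorem hasDerivAt_zero_param_of_coeff [NormedSpace ℂ E] [SMulCommClass ℝ ℂ E]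
    {A₀ A₁ A₂ : ℝ → E →L[ℂ] E} {f g : ℂ → ℂ} {z₀ : ℂ} {s₀ : ℝ}
    (h₀ : Continuous A₀) (h₁ : Continuous A₁) (h₂ : Continuous A₂)
    (hf : DifferentiableAt ℂ f z₀) (hg : DifferentiableAt ℂ g z₀)
    {y : ℂ → ℝ → E}
    (hy : ∀ᶠ z in 𝓝 z₀, ∀ s, HasDerivAt (y z) ((A₀ s + f z • A₁ s + g z • A₂ s) (y z s)) s)
    (hz : y z₀ s₀ = 0) (h0 : HasDerivAt (fun z => y z s₀) 0 z₀) (s : ℝ) :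
    y z₀ s = 0 ∧ HasDerivAt (fun z => y z s) 0 z₀ := by
  have hy0 : y z₀ = fun _ => 0 := solution_unique (s₀ := s₀)
    (A := fun s => A₀ s + f z₀ • A₁ s + g z₀ • A₂ s) (by fun_prop) hy.self_of_nhds
    (fun s => by simpa using hasDerivAt_const s (0 : E)) hz
  refine ⟨by rw [hy0], ?_⟩
  -- Along the zero solution the variational equation has no source, so `χ = 0` solves it.
  exact hasDerivAt_param (A := fun z s => A₀ s + f z • A₁ s + g z • A₂ s)
    (B := fun s => deriv f z₀ • A₁ s + deriv g z₀ • A₂ s) (s₀ := s₀) (χ := fun _ => 0)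
    (by fun_prop) (by fun_prop)
    (eventually_norm_coeff_sub_le A₀ s₀ h₁ h₂ hf hg |s - s₀|) hy
    (fun s => by simpa [hy0] using hasDerivAt_const s (0 : E)) h0 le_rfl

/-- The mean value inequality, with continuity of `f'` made uniform on a compact `s`-interval. It
supplies the remainder estimate of `hasDerivAt_param` when the parameter is the space variable. -/
theorem eventually_norm_sub_sub_le {F : Type*} [NormedAddCommGroup F] [NormedSpace ℝ F]
    {f f' : ℝ → ℝ → F} (hf : ∀ x s, HasDerivAt (fun y => f y s) (f' x s) x)
    (hf' : Continuous (Function.uncurry f')) (x s₀ R ε : ℝ) (hε : 0 < ε) :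
    ∀ᶠ y in 𝓝 x, ∀ s, |s - s₀| ≤ R → ‖f y s - f x s - (y - x) • f' x s‖ ≤ ε * ‖y - x‖ := by
  have h1 : ∀ᶠ y in 𝓝 x, ∀ s ∈ Metric.closedBall s₀ R, ‖f' y s - f' x s‖ < ε := by
    refine (isCompact_closedBall s₀ R).eventually_forall_of_forall_eventually fun s _ => ?_
    have hc : Continuous fun p : ℝ × ℝ => ‖f' p.1 p.2 - f' x p.2‖ :=
      (hf'.sub (hf'.comp (continuous_const.prodMk continuous_snd))).norm
    exact (hc.tendsto (x, s)).eventually (gt_mem_nhds (by simpa using hε))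
  obtain ⟨δ, hδ, hb⟩ := Metric.eventually_nhds_iff_ball.1 h1
  filter_upwards [Metric.ball_mem_nhds x hδ] with y hy s hs
  have := (convex_ball x δ).norm_image_sub_le_of_norm_hasDerivWithin_le (𝕜 := ℝ)
    (f := fun y => f y s - (y - x) • f' x s) (f' := fun y => f' y s - f' x s) (C := ε)
    (fun y _ => by
      have := (hf y s).sub (((hasDerivAt_id y).sub_const x).smul_const (f' x s))
      simp only [one_smul] at this
      exact this.hasDerivWithinAt)
    (fun y hy => (hb y hy s (by simpa [Real.dist_eq] using hs)).le)
    (Metric.mem_ball_self hδ) hy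
  simpa [sub_right_comm] using this

/-- A compatible pair of linear equations `ψ_x = A ψ`, `ψ_t = B ψ` has a solution with any given
initial value. -/
theorem exists_solution_of_compatible [CompleteSpace E] {A A' B B' : ℝ → ℝ → E →L[ℝ] E}
    (hAx : Continuous fun x => A x 0) (hA' : ∀ x t, HasDerivAt (A x) (A' x t) t)
    (hB : ∀ x, Continuous (B x)) (hBx : ∀ x t, HasDerivAt (fun y => B y t) (B' x t) x)
    (hB' : Continuous (Function.uncurry B'))
    (hcomp : ∀ x t, B' x t + B x t * A x t = A' x t + A x t * B x t) (x₀ : ℝ) (v : E) :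
    ∃ ψ : ℝ → ℝ → E, ψ x₀ 0 = v ∧ (∀ x t, HasDerivAt (fun y => ψ y t) (A x t (ψ x t)) x) ∧
      ∀ x t, HasDerivAt (ψ x) (B x t (ψ x t)) t := by
  obtain ⟨φ, hφ0, hφ⟩ := exists_solution x₀ v hAx
  choose ψ hψ0 hψ using fun x => exists_solution 0 (φ x) (hB x)
  refine ⟨ψ, by rw [hψ0, hφ0], fun x t => ?_, hψ⟩
  -- Solve in `x` along `t = 0`, then in `t` on each vertical line, with `x` as a parameter. The
  -- compatibility identity says that `A ψ` satisfies the variational equation of the `t`-flow, so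
  -- it is `ψ_x`.
  refine hasDerivAt_param (𝕜 := ℝ) (A := B) (B := B' x) (z₀ := x) (s₀ := 0) (y := ψ) (R := |t - 0|)
    (χ := fun s => A x s (ψ x s)) (hB x) (hB'.comp (Continuous.prodMk_right x))
    (eventually_norm_sub_sub_le hBx hB' x 0 _) (Eventually.of_forall hψ) (fun s => ?_) ?_ le_rfl
  · have h := (hA' x s).clm_apply (hψ x s)
    have e : B' x s (ψ x s) + B x s (A x s (ψ x s)) = A' x s (ψ x s) + A x s (B x s (ψ x s)) :=
      DFunLike.congr_fun (hcomp x s) (ψ x s)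
    rwa [e]
  · simp only [hψ0]
    exact hφ x

theorem solution_unique_of_pair {A B : ℝ → ℝ → E →L[ℝ] E}
    (hAx : Continuous fun x => A x 0) (hB : ∀ x, Continuous (B x)) {ψ φ : ℝ → ℝ → E}
    (hψx : ∀ x t, HasDerivAt (fun y => ψ y t) (A x t (ψ x t)) x)
    (hψt : ∀ x t, HasDerivAt (ψ x) (B x t (ψ x t)) t)
    (hφx : ∀ x t, HasDerivAt (fun y => φ y t) (A x t (φ x t)) x)
    (hφt : ∀ x t, HasDerivAt (φ x) (B x t (φ x t)) t) {x₀ : ℝ} (h : ψ x₀ 0 = φ x₀ 0) : ψ = φ := by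
  have h0 : (fun x => ψ x 0) = fun x => φ x 0 :=
    solution_unique hAx (fun x => hψx x 0) (fun x => hφx x 0) (s₀ := x₀) h
  funext x
  exact solution_unique (hB x) (hψt x) (hφt x) (s₀ := 0) (congrFun h0 x)

end LinearODE

/-! ### Matrices as linear maps, and the Lax pair: compatibility and holomorphic dependence on `z`.
-/

namespace KunduEckhaus

open NZBCPotential

/-- A `2 × 2` matrix as a continuous linear map. -/
noncomputable def mvC (M : Matrix (Fin 2) (Fin 2) ℂ) : (Fin 2 → ℂ) →L[ℂ] (Fin 2 → ℂ) :=
  LinearMap.toContinuousLinearMap (Matrix.mulVecLin M)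

@[simp] theorem mvC_apply (M : Matrix (Fin 2) (Fin 2) ℂ) (v : Fin 2 → ℂ) : mvC M v = M *ᵥ v := rfl

theorem mvC_add (M N : Matrix (Fin 2) (Fin 2) ℂ) : mvC (M + N) = mvC M + mvC N := by
  ext v; simp [Matrix.add_mulVec]

theorem mvC_smul (c : ℂ) (M : Matrix (Fin 2) (Fin 2) ℂ) : mvC (c • M) = c • mvC M := by
  ext v; simp [Matrix.smul_mulVec]

theorem mvC_mul (M N : Matrix (Fin 2) (Fin 2) ℂ) : mvC (M * N) = mvC M * mvC N :=
  ContinuousLinearMap.ext fun v => (Matrix.mulVec_mulVec v M N).symm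

theorem mvC_entries (a b c d : ℂ) : mvC !![a, b; c, d] =
    a • mvC !![1, 0; 0, 0] + b • mvC !![0, 1; 0, 0] + c • mvC !![0, 0; 1, 0]
      + d • mvC !![0, 0; 0, 1] := by
  simp only [← mvC_smul, ← mvC_add]
  congr 1
  ext i j
  fin_cases i <;> fin_cases j <;> simp

theorem continuous_mvC {X : Type*} [TopologicalSpace X] {a b c d : X → ℂ} (ha : Continuous a)
    (hb : Continuous b) (hc : Continuous c) (hd : Continuous d) :
    Continuous fun x => mvC !![a x, b x; c x, d x] := by
  rw [funext fun x => mvC_entries (a x) (b x) (c x) (d x)]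
  fun_prop

theorem norm_mvC_le (a b c d : ℂ) : ‖mvC !![a, b; c, d]‖ ≤ ‖a‖ + ‖b‖ + ‖c‖ + ‖d‖ := by
  refine ContinuousLinearMap.opNorm_le_bound _ (by positivity) fun v => ?_
  have h0 := norm_le_pi_norm v 0
  have h1 := norm_le_pi_norm v 1
  have hv := norm_nonneg v
  refine (pi_norm_le_iff_of_nonneg (by positivity)).2 fun i => ?_
  have key : ∀ p q : ℂ, ‖p * v 0 + q * v 1‖ ≤ (‖p‖ + ‖q‖) * ‖v‖ := fun p q => by
    refine (norm_add_le _ _).trans ?_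
    rw [norm_mul, norm_mul, add_mul]
    gcongr
  have ha := norm_nonneg a
  have hb := norm_nonneg b
  have hc := norm_nonneg c
  have hd := norm_nonneg d
  fin_cases i
  · have := key a b
    simp [Matrix.mulVec, dotProduct]
    nlinarith [mul_nonneg hc hv, mul_nonneg hd hv]
  · have := key c d
    simp [Matrix.mulVec, dotProduct]
    nlinarith [mul_nonneg ha hv, mul_nonneg hb hv]

/-- A `2 × 2` complex matrix as a real continuous linear map. -/
noncomputable def mvR (M : Matrix (Fin 2) (Fin 2) ℂ) : (Fin 2 → ℂ) →L[ℝ] (Fin 2 → ℂ) :=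
  (mvC M).restrictScalars ℝ

@[simp] theorem mvR_apply (M : Matrix (Fin 2) (Fin 2) ℂ) (v : Fin 2 → ℂ) : mvR M v = M *ᵥ v := rfl

theorem mvR_add (M N : Matrix (Fin 2) (Fin 2) ℂ) : mvR (M + N) = mvR M + mvR N := by
  ext v; simp [Matrix.add_mulVec]

theorem mvR_mul (M N : Matrix (Fin 2) (Fin 2) ℂ) : mvR (M * N) = mvR M * mvR N :=
  ContinuousLinearMap.ext fun v => (Matrix.mulVec_mulVec v M N).symm

theorem mvR_smul (c : ℂ) (M : Matrix (Fin 2) (Fin 2) ℂ) : mvR (c • M) = c • mvR M := by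
  ext v; simp [Matrix.smul_mulVec]

theorem mvR_entries (a b c d : ℂ) : mvR !![a, b; c, d] =
    a • mvR !![1, 0; 0, 0] + b • mvR !![0, 1; 0, 0] + c • mvR !![0, 0; 1, 0]
      + d • mvR !![0, 0; 0, 1] := by
  simp only [← mvR_smul, ← mvR_add]
  congr 1
  ext i j
  fin_cases i <;> fin_cases j <;> simp

theorem continuous_mvR {X : Type*} [TopologicalSpace X] {a b c d : X → ℂ} (ha : Continuous a)
    (hb : Continuous b) (hc : Continuous c) (hd : Continuous d) :
    Continuous fun x => mvR !![a x, b x; c x, d x] := by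
  rw [funext fun x => mvR_entries (a x) (b x) (c x) (d x)]
  fun_prop

theorem hasDerivAt_mvR {a b c d : ℝ → ℂ} {a' b' c' d' : ℂ} {x : ℝ} (ha : HasDerivAt a a' x)
    (hb : HasDerivAt b b' x) (hc : HasDerivAt c c' x) (hd : HasDerivAt d d' x) :
    HasDerivAt (fun x => mvR !![a x, b x; c x, d x]) (mvR !![a', b'; c', d']) x := by
  rw [funext fun x => mvR_entries (a x) (b x) (c x) (d x), mvR_entries a']
  exact (((ha.smul_const (mvR !![1, 0; 0, 0])).add (hb.smul_const (mvR !![0, 1; 0, 0]))).add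
    (hc.smul_const (mvR !![0, 0; 1, 0]))).add (hd.smul_const (mvR !![0, 0; 0, 1]))

theorem hasDerivAt_conj {f : ℝ → ℂ} {f' : ℂ} {x : ℝ} (h : HasDerivAt f f' x) :
    HasDerivAt (fun x => conj (f x)) (conj f') x := by
  simpa using! (Complex.conjCLE.toContinuousLinearMap.hasFDerivAt.comp_hasDerivAt x h)

namespace NZBCPotential

variable (P : NZBCPotential)

noncomputable def qx (x t : ℝ) : ℂ := deriv (fun y => P.q y t) x
noncomputable def qt (x t : ℝ) : ℂ := deriv (fun s => P.q x s) t
noncomputable def qxx (x t : ℝ) : ℂ := deriv (deriv (fun y => P.q y t)) x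

theorem hasDerivAt_q_x (x t : ℝ) : HasDerivAt (fun y => P.q y t) (P.qx x t) x :=
  (P.diff_x x t).hasDerivAt

theorem hasDerivAt_q_t (x t : ℝ) : HasDerivAt (fun s => P.q x s) (P.qt x t) t :=
  (P.diff_t x t).hasDerivAt

theorem hasDerivAt_qx (x t : ℝ) : HasDerivAt (fun y => P.qx y t) (P.qxx x t) x :=
  (P.diff_xx x t).hasDerivAt

theorem continuous_qx : Continuous fun p : ℝ × ℝ => P.qx p.1 p.2 := P.cont_x

theorem continuous_qxx : Continuous fun p : ℝ × ℝ => P.qxx p.1 p.2 := P.cont_xx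

theorem continuous_q_t (x : ℝ) : Continuous fun t => P.q x t :=
  continuous_iff_continuousAt.2 fun t => (P.diff_t x t).continuousAt

theorem continuous_q_x (t : ℝ) : Continuous fun x => P.q x t :=
  continuous_iff_continuousAt.2 fun x => (P.diff_x x t).continuousAt

/-- The structure asks for joint continuity of the derivatives only; that of `q` itself is recovered
by integrating `q_x` from the line `x = 0`. -/
theorem continuous_q : Continuous fun p : ℝ × ℝ => P.q p.1 p.2 := by
  have h : ∀ p : ℝ × ℝ, P.q p.1 p.2 = P.q 0 p.2 + ∫ y in (0 : ℝ)..p.1, P.qx y p.2 := fun p => by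
    have hc : Continuous fun y => P.qx y p.2 :=
      P.continuous_qx.comp (continuous_id.prodMk continuous_const)
    rw [intervalIntegral.integral_eq_sub_of_hasDerivAt (fun y _ => P.hasDerivAt_q_x y p.2)
      (hc.intervalIntegrable _ _)]
    ring
  simp_rw [h]
  refine ((P.continuous_q_t 0).comp continuous_snd).add ?_
  refine intervalIntegral.continuous_parametric_intervalIntegral_of_continuous
    (f := fun (p : ℝ × ℝ) y => P.qx y p.2) ?_ continuous_fst
  exact P.continuous_qx.comp (continuous_snd.prodMk (continuous_snd.comp continuous_fst))

theorem equation' (x t : ℝ) :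
    P.qt x t = I * ((1 / 2) * P.qxx x t + (P.q x t * conj (P.q x t) - (P.q₀ : ℂ) ^ 2) * P.q x t) := by
  have h := P.equation x t
  rw [← Complex.mul_conj'] at h
  change I * P.qt x t + (1 / 2) * P.qxx x t + _ = 0 at h
  linear_combination (-I) * h + (P.qt x t) * Complex.I_sq

theorem laxX_eq (x t : ℝ) (z : ℂ) :
    P.laxX x t z = !![-(I * P.k z), P.q x t; -conj (P.q x t), I * P.k z] := by
  ext i j
  fin_cases i <;> fin_cases j <;> simp [laxX, sigma3, offDiag]

theorem laxT_eq (x t : ℝ) (z : ℂ) : P.laxT x t z =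
    !![-(I * P.k z ^ 2) - I / 2 * (P.q₀ ^ 2 - P.q x t * conj (P.q x t)),
        P.k z * P.q x t + I / 2 * P.qx x t;
      -(P.k z * conj (P.q x t)) + I / 2 * conj (P.qx x t),
        I * P.k z ^ 2 + I / 2 * (P.q₀ ^ 2 - P.q x t * conj (P.q x t))] := by
  ext i j
  fin_cases i <;> fin_cases j <;> simp [laxT, sigma3, offDiag, qx, Matrix.mul_apply,
    Matrix.one_apply] <;> ring

/-- A simultaneous solution of the Lax pair. -/
def IsSol (z : ℂ) (ψ : ℝ → ℝ → Fin 2 → ℂ) : Prop :=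
  (∀ x t : ℝ, HasDerivAt (fun y => ψ y t) (P.laxX x t z *ᵥ ψ x t) x) ∧
  (∀ x t : ℝ, HasDerivAt (fun s => ψ x s) (P.laxT x t z *ᵥ ψ x t) t)

theorem continuous_mvR_laxX (t : ℝ) (z : ℂ) : Continuous fun x => mvR (P.laxX x t z) := by
  have h := P.continuous_q_x t
  simp_rw [laxX_eq]
  exact continuous_mvR continuous_const h (by fun_prop) continuous_const

theorem continuous_mvR_laxT (x : ℝ) (z : ℂ) : Continuous fun t => mvR (P.laxT x t z) := by
  have h := P.continuous_q_t x
  have h' : Continuous fun t => P.qx x t := P.continuous_qx.comp (Continuous.prodMk_right x)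
  simp_rw [laxT_eq]
  refine continuous_mvR ?_ ?_ ?_ ?_ <;> fun_prop

/-- The Lax pair is compatible. -/
theorem exists_isSol (z : ℂ) (x₀ : ℝ) (v : Fin 2 → ℂ) : ∃ ψ, ψ x₀ 0 = v ∧ P.IsSol z ψ := by
  obtain ⟨ψ, h0, hx, ht⟩ := LinearODE.exists_solution_of_compatible (E := Fin 2 → ℂ)
    (A := fun x t => mvR (P.laxX x t z)) (B := fun x t => mvR (P.laxT x t z))
    (A' := fun x t => mvR !![0, P.qt x t; -conj (P.qt x t), 0])
    (B' := fun x t => mvR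
      !![I / 2 * (P.qx x t * conj (P.q x t) + P.q x t * conj (P.qx x t)),
        P.k z * P.qx x t + I / 2 * P.qxx x t;
        -(P.k z * conj (P.qx x t)) + I / 2 * conj (P.qxx x t),
        -(I / 2 * (P.qx x t * conj (P.q x t) + P.q x t * conj (P.qx x t)))])
    (P.continuous_mvR_laxX 0 z)
    (fun x t => by
      simp_rw [laxX_eq]
      have h := P.hasDerivAt_q_t x t
      exact hasDerivAt_mvR (hasDerivAt_const _ _) h (hasDerivAt_conj h).neg (hasDerivAt_const _ _))
    (fun x => P.continuous_mvR_laxT x z)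
    (fun x t => by
      simp_rw [laxT_eq]
      have h := P.hasDerivAt_q_x x t
      have h' := hasDerivAt_conj h
      have g := P.hasDerivAt_qx x t
      have g' := hasDerivAt_conj g
      have m := (((h.mul h').const_sub ((P.q₀ : ℂ) ^ 2)).const_mul (I / 2))
      refine hasDerivAt_mvR ?_ ((h.const_mul _).add (g.const_mul _))
        ((h'.const_mul _).neg.add (g'.const_mul _)) ?_
      · convert! m.const_sub (-(I * P.k z ^ 2)) using 1; ring
      · convert! m.const_add (I * P.k z ^ 2) using 1; ring)
    (by
      have h := P.continuous_q
      have h' := P.continuous_qx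
      have h'' := P.continuous_qxx
      refine continuous_mvR ?_ ?_ ?_ ?_ <;> fun_prop)
    -- Zero curvature: the diagonal entries cancel identically, and the off-diagonal ones are the
    -- evolution equation and its conjugate. No mixed derivative of `q` occurs, since only `X` is
    -- differentiated in `t`.
    (fun x t => by
      rw [← mvR_mul, ← mvR_mul, ← mvR_add, ← mvR_add]
      congr 1
      have e := P.equation' x t
      have e' := congrArg conj e
      simp only [map_mul, map_add, map_sub, map_pow, conj_I, conj_ofReal, conj_conj, map_div₀, map_one, map_ofNat] at e'
      rw [laxX_eq, laxT_eq, e', e]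
      ext i j
      fin_cases i <;> fin_cases j <;> simp
      · ring
      · linear_combination (P.k z * P.qx x t) * Complex.I_sq
      · linear_combination (-(P.k z * conj (P.qx x t))) * Complex.I_sq
      · ring) x₀ v
  exact ⟨ψ, h0, hx, ht⟩

variable {P}

theorem IsSol.eq_of_eq {z : ℂ} {ψ φ : ℝ → ℝ → Fin 2 → ℂ} (hψ : P.IsSol z ψ) (hφ : P.IsSol z φ)
    {x₀ : ℝ} (h : ψ x₀ 0 = φ x₀ 0) : ψ = φ :=
  LinearODE.solution_unique_of_pair (A := fun x t => mvR (P.laxX x t z))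
    (B := fun x t => mvR (P.laxT x t z)) (P.continuous_mvR_laxX 0 z)
    (fun x => P.continuous_mvR_laxT x z) hψ.1 hψ.2 hφ.1 hφ.2 h

theorem IsSol.add {z : ℂ} {ψ φ : ℝ → ℝ → Fin 2 → ℂ} (hψ : P.IsSol z ψ) (hφ : P.IsSol z φ) :
    P.IsSol z (fun x t => ψ x t + φ x t) :=
  ⟨fun x t => by rw [Matrix.mulVec_add]; exact (hψ.1 x t).add (hφ.1 x t),
    fun x t => by rw [Matrix.mulVec_add]; exact (hψ.2 x t).add (hφ.2 x t)⟩

theorem IsSol.smul {z : ℂ} {ψ : ℝ → ℝ → Fin 2 → ℂ} (hψ : P.IsSol z ψ) (c : ℂ) :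
    P.IsSol z (fun x t => c • ψ x t) :=
  ⟨fun x t => by rw [Matrix.mulVec_smul]; exact (hψ.1 x t).const_smul c,
    fun x t => by rw [Matrix.mulVec_smul]; exact (hψ.2 x t).const_smul c⟩

theorem mvC_laxX_eq (x t : ℝ) (z : ℂ) : mvC (P.laxX x t z) =
    mvC !![0, P.q x t; -conj (P.q x t), 0] + P.k z • mvC !![-I, 0; 0, I] +
      (0 : ℂ) • mvC 0 := by
  rw [← mvC_smul, ← mvC_smul, ← mvC_add, ← mvC_add, laxX_eq]
  congr 1
  ext i j
  fin_cases i <;> fin_cases j <;> simp [mul_comm]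

theorem mvC_laxT_eq (x t : ℝ) (z : ℂ) : mvC (P.laxT x t z) =
    mvC !![-(I / 2 * (P.q₀ ^ 2 - P.q x t * conj (P.q x t))), I / 2 * P.qx x t;
      I / 2 * conj (P.qx x t), I / 2 * (P.q₀ ^ 2 - P.q x t * conj (P.q x t))]
    + P.k z • mvC !![0, P.q x t; -conj (P.q x t), 0] + P.k z ^ 2 • mvC !![-I, 0; 0, I] := by
  rw [← mvC_smul, ← mvC_smul, ← mvC_add, ← mvC_add, laxT_eq]
  congr 1
  ext i j
  fin_cases i <;> fin_cases j <;> simp <;> ring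

theorem differentiableAt_k {z : ℂ} (hz : z ≠ 0) : DifferentiableAt ℂ P.k z := by
  unfold k; fun_prop (disch := assumption)

theorem continuous_offDiag_x (t : ℝ) :
    Continuous fun x => mvC !![0, P.q x t; -conj (P.q x t), 0] := by
  have := P.continuous_q_x t
  exact continuous_mvC continuous_const this (by fun_prop) continuous_const

theorem continuous_offDiag_t (x : ℝ) :
    Continuous fun t => mvC !![0, P.q x t; -conj (P.q x t), 0] := by
  have := P.continuous_q_t x
  exact continuous_mvC continuous_const this (by fun_prop) continuous_const

theorem continuous_laxT_coeff (x : ℝ) : Continuous fun t =>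
    mvC !![-(I / 2 * (P.q₀ ^ 2 - P.q x t * conj (P.q x t))), I / 2 * P.qx x t;
      I / 2 * conj (P.qx x t), I / 2 * (P.q₀ ^ 2 - P.q x t * conj (P.q x t))] := by
  have := P.continuous_q_t x
  have h' : Continuous fun t => P.qx x t := P.continuous_qx.comp (Continuous.prodMk_right x)
  refine continuous_mvC ?_ ?_ ?_ ?_ <;> fun_prop

/-- Solutions of the `x`-equation at `t = 0` depend holomorphically on `z`. -/
theorem differentiableAt_of_x {z₀ : ℂ} (hz : z₀ ≠ 0) {y : ℂ → ℝ → Fin 2 → ℂ} {x₀ : ℝ}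
    (hy : ∀ᶠ z in 𝓝 z₀, ∀ x, HasDerivAt (y z) (P.laxX x 0 z *ᵥ y z x) x)
    (h0 : DifferentiableAt ℂ (fun z => y z x₀) z₀) (x : ℝ) :
    DifferentiableAt ℂ (fun z => y z x) z₀ := by
  refine LinearODE.differentiableAt_param_of_coeff
    (A₀ := fun x => mvC !![0, P.q x 0; -conj (P.q x 0), 0]) (A₁ := fun _ => mvC !![-I, 0; 0, I])
    (A₂ := fun _ => mvC 0) (f := P.k) (g := fun _ => 0) (continuous_offDiag_x 0) continuous_const
    continuous_const (differentiableAt_k hz) (differentiableAt_const _) ?_ h0 x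
  filter_upwards [hy] with z h x
  rw [← mvC_laxX_eq]; exact h x

theorem differentiableAt_of_isSol {z₀ : ℂ} (hz : z₀ ≠ 0) {ψ : ℂ → ℝ → ℝ → Fin 2 → ℂ} {x₀ : ℝ}
    (hψ : ∀ᶠ z in 𝓝 z₀, P.IsSol z (ψ z)) (h0 : DifferentiableAt ℂ (fun z => ψ z x₀ 0) z₀)
    (x t : ℝ) : DifferentiableAt ℂ (fun z => ψ z x t) z₀ := by
  refine LinearODE.differentiableAt_param_of_coeff
    (f := P.k) (g := fun z => P.k z ^ 2) (continuous_laxT_coeff (P := P) x)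
    (continuous_offDiag_t (P := P) x)
    (A₂ := fun _ => mvC !![-I, 0; 0, I]) (s₀ := 0) (y := fun z t => ψ z x t)
    continuous_const (differentiableAt_k hz) ((differentiableAt_k hz).pow 2) ?_
    (differentiableAt_of_x (y := fun z x => ψ z x 0) hz (hψ.mono fun z h x => h.1 x 0) h0 x) t
  filter_upwards [hψ] with z h t
  rw [← mvC_laxT_eq]; exact h.2 x t

/-- Second-order vanishing in `z` is carried along the line `t = 0` by the `x`-equation and then
along each vertical line by the `t`-equation. This makes the constants `b` and `d` independent of
`(x, t)`. -/
theorem hasDerivAt_zero_of_isSol {z₀ : ℂ} (hz : z₀ ≠ 0) {ψ : ℂ → ℝ → ℝ → Fin 2 → ℂ} {x₀ : ℝ}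
    (hψ : ∀ᶠ z in 𝓝 z₀, P.IsSol z (ψ z)) (h : ψ z₀ x₀ 0 = 0)
    (h0 : HasDerivAt (fun z => ψ z x₀ 0) 0 z₀)
    (x t : ℝ) : HasDerivAt (fun z => ψ z x t) 0 z₀ := by
  have hx := LinearODE.hasDerivAt_zero_param_of_coeff (y := fun z x => ψ z x 0)
    (A₀ := fun x => mvC !![0, P.q x 0; -conj (P.q x 0), 0]) (A₁ := fun _ => mvC !![-I, 0; 0, I])
    (A₂ := fun _ => mvC 0) (f := P.k) (g := fun _ => 0) (continuous_offDiag_x 0) continuous_const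
    continuous_const (differentiableAt_k hz) (differentiableAt_const _)
    (by
      filter_upwards [hψ] with z h x
      rw [← mvC_laxX_eq]; exact h.1 x 0) h h0 x
  refine (LinearODE.hasDerivAt_zero_param_of_coeff
    (f := P.k) (g := fun z => P.k z ^ 2) (continuous_laxT_coeff (P := P) x)
    (continuous_offDiag_t (P := P) x)
    (A₂ := fun _ => mvC !![-I, 0; 0, I]) (s₀ := 0) (y := fun z t => ψ z x t)
    continuous_const (differentiableAt_k hz) ((differentiableAt_k hz).pow 2) ?_ hx.1 hx.2 t).2
  filter_upwards [hψ] with z h t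
  rw [← mvC_laxT_eq]; exact h.2 x t

end NZBCPotential

end KunduEckhaus

/-! ### Integrable perturbations of `χ' = M χ`: solutions with a prescribed limit at `+∞`. -/

namespace LinearODE

section Tail

variable {E : Type*} [NormedAddCommGroup E] [NormedSpace ℂ E]

/-- The propagator `e^{sM}` of the constant coefficient equation `χ' = M χ` when `M² = μ M`. -/
noncomputable def propagator (M : E →L[ℂ] E) (μ : ℂ) (s : ℝ) : E →L[ℂ] E :=
  1 + ((exp (μ * s) - 1) / μ) • M

/-- For `s ≤ 0` the factor `e^{μs}` has modulus at most `1`: integrating backwards from `+∞` is the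
stable direction. -/
theorem norm_propagator_le {M : E →L[ℂ] E} {μ : ℂ} (hμ : 0 ≤ μ.re) {s : ℝ} (hs : s ≤ 0) :
    ‖propagator M μ s‖ ≤ 1 + 2 * ‖M‖ / ‖μ‖ := by
  have h1 : ‖exp (μ * s)‖ ≤ 1 := by
    rw [Complex.norm_exp]
    simp only [mul_re, ofReal_re, ofReal_im, mul_zero, sub_zero, Real.exp_le_one_iff]
    exact mul_nonpos_of_nonneg_of_nonpos hμ hs
  have h2 : ‖exp (μ * s) - 1‖ ≤ 2 := by
    refine (norm_sub_le _ _).trans ?_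
    rw [norm_one]; linarith
  refine (norm_add_le _ _).trans (add_le_add ContinuousLinearMap.norm_id_le ?_)
  rw [norm_smul, norm_div, div_mul_eq_mul_div]
  gcongr

theorem propagator_apply_of_apply_eq_zero {M : E →L[ℂ] E} {μ : ℂ} {s : ℝ} {e : E} (h : M e = 0) :
    propagator M μ s e = e := by
  simp [propagator, h]

variable {W : ℝ → E →L[ℂ] E}

/-- The integral of `‖W‖` over `(x, ∞)`. -/
noncomputable def tailNorm (W : ℝ → E →L[ℂ] E) (x : ℝ) : ℝ :=
  (∫ y in Set.Ioi 0, ‖W y‖) - ∫ y in (0 : ℝ)..x, ‖W y‖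

theorem tendsto_tailNorm (hi : IntegrableOn W (Set.Ici 0)) :
    Tendsto (tailNorm W) atTop (𝓝 0) := by
  have h := intervalIntegral_tendsto_integral_Ioi 0
    (IntegrableOn.mono_set hi.norm Set.Ioi_subset_Ici_self) tendsto_id
  have := (tendsto_const_nhds (x := ∫ y in Set.Ioi 0, ‖W y‖)).sub h
  simpa [tailNorm] using! this

theorem integral_norm_le_tailNorm (hW : Continuous W) (hi : IntegrableOn W (Set.Ici 0)) {x N : ℝ}
    (hN : 0 ≤ N) : ∫ y in x..N, ‖W y‖ ≤ tailNorm W x := by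
  have h1 := intervalIntegral.integral_add_adjacent_intervals (a := 0) (b := x) (c := N)
      (hW.norm.intervalIntegrable (μ := volume) _ _) (hW.norm.intervalIntegrable _ _)
  have h2 : ∫ y in (0 : ℝ)..N, ‖W y‖ ≤ ∫ y in Set.Ioi 0, ‖W y‖ := by
    rw [intervalIntegral.integral_of_le hN]
    exact setIntegral_mono_set (IntegrableOn.mono_set hi.norm Set.Ioi_subset_Ici_self)
      (Eventually.of_forall fun _ => norm_nonneg _) (Set.Ioc_subset_Ioi_self.eventuallyLE)
  unfold tailNorm
  linarith

theorem exists_mul_tailNorm_le (hi : IntegrableOn W (Set.Ici 0)) (C : ℝ) :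
    ∃ a : ℝ, 0 ≤ a ∧ C * tailNorm W a ≤ 1 / 2 := by
  have h1 : Tendsto (fun x => C * tailNorm W x) atTop (𝓝 0) := by
    simpa using (tendsto_tailNorm hi).const_mul C
  exact ((eventually_ge_atTop 0).and (h1.eventually (ge_mem_nhds (by norm_num)))).exists

variable [NormedSpace ℝ E] [IsScalarTower ℝ ℂ E]

variable {M : E →L[ℂ] E} {μ : ℂ} {χ : ℝ → E}

/-- Variation of constants: the propagator cancels the contribution of `M`, and only that of `W`
survives. -/
theorem hasDerivAt_propagator_apply (hM : M * M = μ • M) (hμ : μ ≠ 0)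
    (hχ : ∀ x, HasDerivAt χ ((M + W x) (χ x)) x) (x y : ℝ) :
    HasDerivAt (fun y => propagator M μ (x - y) (χ y)) (propagator M μ (x - y) (W y (χ y))) y := by
  have hMM : ∀ v, M (M v) = μ • M v := fun v => DFunLike.congr_fun hM v
  have h1 : HasDerivAt (fun y => M (χ y)) (M ((M + W y) (χ y))) y :=
    (M.restrictScalars ℝ).hasFDerivAt.comp_hasDerivAt y (hχ y)
  have h2 : HasDerivAt (fun y : ℝ => (exp (μ * ((x - y : ℝ) : ℂ)) - 1) / μ)
      (-exp (μ * ((x - y : ℝ) : ℂ))) y := by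
    have h3 : HasDerivAt (fun y : ℝ => μ * ((x - y : ℝ) : ℂ)) (-μ) y := by
      have := (((hasDerivAt_id y).const_sub x).ofReal_comp).const_mul μ
      simpa using! this
    have := ((h3.cexp).sub_const 1).div_const μ
    convert! this using 1
    field_simp
  have h4 := (hχ y).add (h2.smul h1)
  convert! h4 using 1
  simp only [propagator, add_apply, one_apply_eq_self, smul_apply, map_add, smul_add,
    hMM, smul_smul]
  rw [div_mul_cancel₀ _ hμ]
  module

theorem propagator_sub_eq_integral [CompleteSpace E] (hW : Continuous W) (hM : M * M = μ • M) (hμ : μ ≠ 0)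
    (hχ : ∀ x, HasDerivAt χ ((M + W x) (χ x)) x) (x N : ℝ) :
    propagator M μ (x - N) (χ N) - χ x = ∫ y in x..N, propagator M μ (x - y) (W y (χ y)) := by
  have hc : Continuous χ := continuous_iff_continuousAt.2 fun s => (hχ s).continuousAt
  rw [intervalIntegral.integral_eq_sub_of_hasDerivAt
    (f := fun y => propagator M μ (x - y) (χ y))
    (fun y _ => hasDerivAt_propagator_apply hM hμ hχ x y)]
  · simp [propagator]
  · refine Continuous.intervalIntegrable ?_ _ _
    unfold propagator
    fun_prop

theorem norm_sub_propagator_le [CompleteSpace E] (hW : Continuous W) (hM : M * M = μ • M)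
    (hμ : 0 < μ.re) (hχ : ∀ x, HasDerivAt χ ((M + W x) (χ x)) x) {C S : ℝ}
    (hC : 1 + 2 * ‖M‖ / ‖μ‖ ≤ C) {x N : ℝ} (hxN : x ≤ N) (hS : ∀ y ∈ Set.Icc x N, ‖χ y‖ ≤ S) :
    ‖χ x - propagator M μ (x - N) (χ N)‖ ≤ C * S * ∫ y in x..N, ‖W y‖ := by
  have hμ0 : μ ≠ 0 := by rintro rfl; simp at hμ
  rw [norm_sub_rev, propagator_sub_eq_integral hW hM hμ0 hχ, ← intervalIntegral.integral_const_mul]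
  have hC0 : 0 ≤ C := le_trans (by positivity) hC
  refine intervalIntegral.norm_integral_le_of_norm_le hxN (Eventually.of_forall fun y hy => ?_)
    (Continuous.intervalIntegrable (by fun_prop) _ _)
  have h1 : ‖propagator M μ (x - y)‖ ≤ C :=
    (norm_propagator_le hμ.le (by linarith [hy.1])).trans hC
  calc _ ≤ ‖propagator M μ (x - y)‖ * (‖W y‖ * ‖χ y‖) :=
        (ContinuousLinearMap.le_opNorm _ _).trans (by gcongr; exact (W y).le_opNorm _)
    _ ≤ C * (‖W y‖ * S) := by
        gcongr
        exact hS y ⟨hy.1.le, hy.2⟩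
    _ = _ := by ring

/-- The integral equation is evaluated where `‖χ‖` is maximal on `[a, N]`. Smallness of `∫ ‖W‖`
makes the integral term at most half of that maximum, which is absorbed on the left. -/
theorem norm_le_of_tail_small [CompleteSpace E] (hW : Continuous W) (hM : M * M = μ • M)
    (hμ : 0 < μ.re) (hχ : ∀ x, HasDerivAt χ ((M + W x) (χ x)) x) {C a N : ℝ}
    (hC : 1 + 2 * ‖M‖ / ‖μ‖ ≤ C) (haN : a ≤ N) (hsmall : C * ∫ y in a..N, ‖W y‖ ≤ 1 / 2)
    {x : ℝ} (hx : x ∈ Set.Icc a N) : ‖χ x‖ ≤ 2 * C * ‖χ N‖ := by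
  have hc : Continuous χ := continuous_iff_continuousAt.2 fun s => (hχ s).continuousAt
  have hC0 : 0 ≤ C := le_trans (by positivity) hC
  obtain ⟨m, hm, hmax⟩ := isCompact_Icc.exists_isMaxOn (Set.nonempty_Icc.2 haN)
    (f := fun x => ‖χ x‖) hc.norm.continuousOn
  have h1 := norm_sub_propagator_le hW hM hμ hχ hC hm.2 (S := ‖χ m‖)
    (fun y hy => hmax ⟨hm.1.trans hy.1, hy.2⟩)
  have h2 : ∫ y in m..N, ‖W y‖ ≤ ∫ y in a..N, ‖W y‖ := by
    have := intervalIntegral.integral_add_adjacent_intervals (a := a) (b := m) (c := N)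
      (hW.norm.intervalIntegrable (μ := volume) _ _) (hW.norm.intervalIntegrable _ _)
    have h0 : 0 ≤ ∫ y in a..m, ‖W y‖ :=
      intervalIntegral.integral_nonneg hm.1 fun _ _ => norm_nonneg _
    linarith
  have h3 : ‖propagator M μ (m - N) (χ N)‖ ≤ C * ‖χ N‖ :=
    (ContinuousLinearMap.le_opNorm _ _).trans
      (by gcongr; exact (norm_propagator_le hμ.le (by linarith [hm.2])).trans hC)
  have h4 : C * ‖χ m‖ * ∫ y in m..N, ‖W y‖ ≤ 1 / 2 * ‖χ m‖ := by
    calc _ ≤ C * ‖χ m‖ * ∫ y in a..N, ‖W y‖ := by gcongr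
      _ = (C * ∫ y in a..N, ‖W y‖) * ‖χ m‖ := by ring
      _ ≤ _ := by gcongr
  have h5 : ‖χ m‖ ≤ ‖χ m - propagator M μ (m - N) (χ N)‖ + ‖propagator M μ (m - N) (χ N)‖ := by
    simpa using norm_add_le (χ m - propagator M μ (m - N) (χ N)) (propagator M μ (m - N) (χ N))
  have h6 : ‖χ x‖ ≤ ‖χ m‖ := hmax hx
  linarith

/-- The bound of `χ a` by `χ N` has a constant independent of `N`, so letting `N → ∞` gives `χ a =
0`, and uniqueness of the initial value problem does the rest. -/
theorem eq_zero_of_tendsto_zero [CompleteSpace E] (hW : Continuous W)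
    (hi : IntegrableOn W (Set.Ici 0)) (hM : M * M = μ • M)
    (hμ : 0 < μ.re) (hχ : ∀ x, HasDerivAt χ ((M + W x) (χ x)) x)
    (h0 : Tendsto χ atTop (𝓝 0)) : χ = 0 := by
  set C := 1 + 2 * ‖M‖ / ‖μ‖ with hC
  have hC0 : 0 ≤ C := by positivity
  obtain ⟨a, ha0, ha⟩ : ∃ a : ℝ, 0 ≤ a ∧ C * tailNorm W a ≤ 1 / 2 :=
    exists_mul_tailNorm_le hi C
  have hb : ∀ N, a ≤ N → ‖χ a‖ ≤ 2 * C * ‖χ N‖ := fun N hN =>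
    norm_le_of_tail_small hW hM hμ hχ le_rfl hN
      (le_trans (by gcongr; exact integral_norm_le_tailNorm hW hi (ha0.trans hN)) ha)
      (Set.left_mem_Icc.2 hN)
  have hχa : χ a = 0 := by
    have h1 : Tendsto (fun N => 2 * C * ‖χ N‖) atTop (𝓝 0) := by
      simpa using h0.norm.const_mul (2 * C)
    have := ge_of_tendsto h1 ((eventually_ge_atTop a).mono hb)
    simpa using this
  exact solution_unique (A := fun x => M + W x) (s₀ := a) (by fun_prop) hχ
    (fun s => by simp) hχa

end Tail

section Family

variable {E : Type*} [NormedAddCommGroup E] [NormedSpace ℝ E] [NormedSpace ℂ E]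
  [SMulCommClass ℝ ℂ E] [CompleteSpace E]

theorem differentiableAt_param_of_add {M : ℂ → E →L[ℂ] E} {W : ℝ → E →L[ℂ] E} {z₀ : ℂ} {s₀ : ℝ}
    (hM : DifferentiableAt ℂ M z₀) (hW : Continuous W) {y : ℂ → ℝ → E}
    (hy : ∀ᶠ z in 𝓝 z₀, ∀ s, HasDerivAt (y z) ((M z + W s) (y z s)) s)
    (h0 : DifferentiableAt ℂ (fun z => y z s₀) z₀) (s : ℝ) :
    DifferentiableAt ℂ (fun z => y z s) z₀ := by
  refine differentiableAt_param (A := fun z s => M z + W s) (B := fun _ => deriv M z₀) (s₀ := s₀)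
    (fun z => by fun_prop) continuous_const (fun R ε hε => ?_) hy h0 s
  have h := hasDerivAt_iff_isLittleO.1 hM.hasDerivAt
  rw [Asymptotics.isLittleO_iff] at h
  filter_upwards [h hε] with z hz s _
  simpa using hz

variable [IsScalarTower ℝ ℂ E]

/-- Existence of solutions of `χ' = (M(z) + W(x)) χ` with `χ → e(z)` as `x → ∞`, where
`M(z) e(z) = 0`, and their holomorphic dependence on `z`. -/
theorem exists_solution_tendsto {M : ℂ → E →L[ℂ] E} {μ : ℂ → ℂ} {e : ℂ → E} {W : ℝ → E →L[ℂ] E}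
    {U : Set ℂ} (hU : IsOpen U) (hMd : DifferentiableOn ℂ M U) (hμd : ContinuousOn μ U)
    (hed : DifferentiableOn ℂ e U) (hM : ∀ z ∈ U, M z * M z = μ z • M z)
    (hμ : ∀ z ∈ U, 0 < (μ z).re) (hMe : ∀ z ∈ U, M z (e z) = 0) (hW : Continuous W)
    (hi : IntegrableOn W (Set.Ici 0)) {z₀ : ℂ} (hz₀ : z₀ ∈ U) :
    ∃ (χ : ℂ → ℝ → E) (x₀ : ℝ), DifferentiableAt ℂ (fun z => χ z x₀) z₀ ∧
      ∀ᶠ z in 𝓝 z₀, (∀ x, HasDerivAt (χ z) ((M z + W x) (χ z x)) x) ∧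
        Tendsto (χ z) atTop (𝓝 (e z)) := by
  have hμ0 : ∀ z ∈ U, μ z ≠ 0 := fun z hz h => by simpa [h] using hμ z hz
  have hUn := hU.mem_nhds hz₀
  obtain ⟨C, hC⟩ : ∃ C, ∀ᶠ z in 𝓝 z₀, 1 + 2 * ‖M z‖ / ‖μ z‖ ≤ C := by
    have h1 : ContinuousAt (fun z => 1 + 2 * ‖M z‖ / ‖μ z‖) z₀ := by
      have := (hMd.continuousOn.continuousAt hUn).norm
      have h2 := (hμd.continuousAt hUn).norm
      exact continuousAt_const.add ((continuousAt_const.mul this).div h2 (by simpa using hμ0 z₀ hz₀))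
    exact ⟨_, (h1.eventually (gt_mem_nhds (lt_add_one _))).mono fun z hz => hz.le⟩
  obtain ⟨Ce, hCe⟩ : ∃ Ce, ∀ᶠ z in 𝓝 z₀, ‖e z‖ ≤ Ce :=
    ⟨_, ((hed.continuousOn.continuousAt hUn).norm.eventually (gt_mem_nhds (lt_add_one _))).mono
      fun z hz => hz.le⟩
  obtain ⟨r, hr, hball⟩ := Metric.eventually_nhds_iff_ball.1 (hC.and (hCe.and hUn))
  have hz₀b : z₀ ∈ Metric.ball z₀ r := Metric.mem_ball_self hr
  have hC0 : 0 ≤ C := le_trans (by positivity) (hball z₀ hz₀b).1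
  have hCe0 : 0 ≤ Ce := (norm_nonneg _).trans (hball z₀ hz₀b).2.1
  obtain ⟨x₀, hx₀, hsm⟩ : ∃ a : ℝ, 0 ≤ a ∧ C * tailNorm W a ≤ 1 / 2 :=
    exists_mul_tailNorm_le hi C
  have hAc : ∀ z, Continuous fun x => M z + W x := fun z => by fun_prop
  -- The approximations start from the exact limit `e z` at the finite point `x₀ + N`.
  choose y hyN hy using fun (N : ℕ) (z : ℂ) => exists_solution (x₀ + N) (e z) (hAc z)
  have small : ∀ N : ℝ, x₀ ≤ N → C * ∫ y in x₀..N, ‖W y‖ ≤ 1 / 2 := fun N hN =>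
    le_trans (by gcongr; exact integral_norm_le_tailNorm hW hi (hx₀.trans hN)) hsm
  -- the approximations are close to `e z`
  have close : ∀ z ∈ Metric.ball z₀ r, ∀ N : ℕ, ∀ x ∈ Set.Icc x₀ (x₀ + N),
      ‖y N z x - e z‖ ≤ 2 * C ^ 2 * Ce * tailNorm W x := by
    intro z hz N x hx
    obtain ⟨hCz, hez, hzU⟩ := hball z hz
    have hxN : x₀ ≤ x₀ + N := by simp
    have h1 := norm_sub_propagator_le hW (hM z hzU) (hμ z hzU) (hy N z) hCz hx.2
      (S := 2 * C * ‖e z‖) (fun u hu => by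
        have := norm_le_of_tail_small hW (hM z hzU) (hμ z hzU) (hy N z) hCz hxN (small _ hxN)
          (x := u) ⟨hx.1.trans hu.1, hu.2⟩
        rwa [hyN] at this)
    -- The propagator fixes `e z` because `M z (e z) = 0`, so `y N z` stays near `e z` up to the
    -- tail of `W`.
    rw [hyN, propagator_apply_of_apply_eq_zero (hMe z hzU)] at h1
    have h2 := integral_norm_le_tailNorm hW hi (x := x) (hx₀.trans hxN)
    have h3 : 0 ≤ ∫ y in x..(x₀ + N), ‖W y‖ :=
      intervalIntegral.integral_nonneg hx.2 fun _ _ => norm_nonneg _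
    calc _ ≤ C * (2 * C * ‖e z‖) * ∫ y in x..(x₀ + N), ‖W y‖ := h1
      _ ≤ C * (2 * C * Ce) * tailNorm W x := by gcongr
      _ = _ := by ring
  set b : ℕ → ℝ := fun N => 2 * C * (2 * C ^ 2 * Ce * tailNorm W (x₀ + N)) with hb
  have hb0 : Tendsto b atTop (𝓝 0) := by
    have h1 : Tendsto (fun N : ℕ => x₀ + (N : ℝ)) atTop atTop :=
      tendsto_atTop_add_const_left _ _ tendsto_natCast_atTop_atTop
    have := (((tendsto_tailNorm hi).comp h1).const_mul (2 * C ^ 2 * Ce)).const_mul (2 * C)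
    simpa using! this
  have cauchy : ∀ z ∈ Metric.ball z₀ r, ∀ N N' : ℕ, N ≤ N' → ‖y N' z x₀ - y N z x₀‖ ≤ b N := by
    intro z hz N N' hNN
    obtain ⟨hCz, hez, hzU⟩ := hball z hz
    have hxN : x₀ ≤ x₀ + N := by simp
    -- The difference of two approximations solves the same equation, so its size at `x₀` is
    -- controlled by that at `x₀ + N`, where `y N z` equals `e z` and `y N' z` is close to it.
    have h1 := norm_le_of_tail_small hW (hM z hzU) (hμ z hzU) (χ := fun x => y N' z x - y N z x)
      (fun x => by rw [map_sub]; exact (hy N' z x).sub (hy N z x)) hCz hxN (small _ hxN)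
      (Set.left_mem_Icc.2 hxN)
    refine h1.trans ?_
    rw [hyN]
    simp only [hb]
    gcongr
    exact close z hz N' (x₀ + N) ⟨hxN, by gcongr⟩
  have hlim : ∀ z ∈ Metric.ball z₀ r, ∃ v, Tendsto (fun N => y N z x₀) atTop (𝓝 v) := by
    intro z hz
    refine cauchySeq_tendsto_of_complete (cauchySeq_of_le_tendsto_0' b (fun n m hnm => ?_) hb0)
    rw [dist_comm, dist_eq_norm]
    exact cauchy z hz n m hnm
  choose! F hF using hlim
  have hunif : TendstoUniformlyOn (fun N z => y N z x₀) F atTop (Metric.ball z₀ r) := by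
    rw [Metric.tendstoUniformlyOn_iff]
    intro ε hε
    filter_upwards [hb0.eventually (gt_mem_nhds hε)] with N hN z hz
    refine lt_of_le_of_lt ?_ hN
    rw [dist_eq_norm]
    exact le_of_tendsto ((hF z hz).sub_const _).norm
      ((eventually_ge_atTop N).mono fun N' h => cauchy z hz N N' h)
  -- The bound `b N` does not involve `z`, so the limit is uniform on the ball and holomorphy passes
  -- to `F`.
  have hFd : DifferentiableOn ℂ F (Metric.ball z₀ r) := by
    refine hunif.tendstoLocallyUniformlyOn.differentiableOn (Eventually.of_forall fun N z hz => ?_)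
      Metric.isOpen_ball
    have hzU := hU.mem_nhds (hball z hz).2.2
    refine (differentiableAt_param_of_add (hMd.differentiableAt hzU) hW (s₀ := x₀ + N)
      (Eventually.of_forall (hy N)) ?_ x₀).differentiableWithinAt
    simp only [hyN]
    exact hed.differentiableAt hzU
  choose χ hχ0 hχ using fun z => exists_solution x₀ (F z) (hAc z)
  refine ⟨χ, x₀, ?_, ?_⟩
  · simp only [hχ0]
    exact hFd.differentiableAt (Metric.ball_mem_nhds z₀ hr)
  filter_upwards [Metric.ball_mem_nhds z₀ hr] with z hz
  refine ⟨hχ z, ?_⟩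
  have hconv : ∀ x, Tendsto (fun N => y N z x) atTop (𝓝 (χ z x)) := by
    intro x
    obtain ⟨K, hK, hKb⟩ := exists_bound x₀ (hAc z) |x - x₀|
    rw [tendsto_iff_norm_sub_tendsto_zero]
    have h1 := tendsto_iff_norm_sub_tendsto_zero.1 (hF z hz)
    refine squeeze_zero (fun _ => norm_nonneg _) (fun N => ?_)
      (by simpa using h1.mul_const (Real.exp ((K + 1) * |x - x₀|)))
    have := norm_solution_le (y := fun x => y N z x - χ z x) hK hKb
      (fun x => by rw [map_sub]; exact (hy N z x).sub (hχ z x)) le_rfl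
    rwa [hχ0] at this
  have hest : ∀ x, x₀ ≤ x → ‖χ z x - e z‖ ≤ 2 * C ^ 2 * Ce * tailNorm W x := by
    intro x hx
    refine le_of_tendsto ((hconv x).sub_const _).norm ?_
    obtain ⟨N₀, hN₀⟩ := exists_nat_ge (x - x₀)
    filter_upwards [eventually_ge_atTop N₀] with N hN
    have : (N₀ : ℝ) ≤ N := by exact_mod_cast hN
    exact close z hz N x ⟨hx, by linarith⟩
  rw [tendsto_iff_norm_sub_tendsto_zero]
  refine squeeze_zero' (Eventually.of_forall fun _ => norm_nonneg _)
    ((eventually_ge_atTop x₀).mono hest) ?_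
  simpa using (tendsto_tailNorm hi).const_mul (2 * C ^ 2 * Ce)

end Family

end LinearODE

/-! ### The Jost column `ψ_{+,1}` on `D⁻`: existence, uniqueness, holomorphy. -/

namespace KunduEckhaus

namespace NZBCPotential

variable (P : NZBCPotential)

theorem lam_im (z : ℂ) (hz : z ≠ 0) :
    (P.lam z).im = (‖z‖ ^ 2 - P.q₀ ^ 2) * z.im / (2 * ‖z‖ ^ 2) := by
  have hn : normSq z = ‖z‖ ^ 2 := Complex.normSq_eq_norm_sq z
  have hz' : ‖z‖ ≠ 0 := norm_ne_zero_iff.2 hz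
  have h2 : ((P.q₀ : ℂ) ^ 2 / z).im = -(P.q₀ ^ 2 * z.im / ‖z‖ ^ 2) := by
    rw [← ofReal_pow, Complex.div_im, hn, ofReal_im, ofReal_re]
    ring
  have h3 : (P.lam z).im = (z.im + ((P.q₀ : ℂ) ^ 2 / z).im) / 2 := by
    unfold lam
    rw [show (2 : ℂ) = ((2 : ℝ) : ℂ) by norm_num, Complex.div_ofReal_im, Complex.add_im]
  rw [h3, h2]
  field_simp
  ring

variable {P}

theorem ne_zero_of_mem_DMinus {z : ℂ} (hz : z ∈ P.DMinus) : z ≠ 0 := by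
  rintro rfl; simp [DMinus] at hz

theorem ne_zero_of_mem_DPlus {z : ℂ} (hz : z ∈ P.DPlus) : z ≠ 0 := by
  rintro rfl; simp [DPlus] at hz

/-- The zeros `±i q₀` of `γ` lie on the circle `|z| = q₀`, which belongs to neither region. -/
theorem gam_ne_zero {z : ℂ} (hz : z ≠ 0) (h : (‖z‖ ^ 2 - P.q₀ ^ 2) * z.im ≠ 0) : P.gam z ≠ 0 := by
  intro h0
  apply h
  unfold gam at h0
  have h1 : z ^ 2 = -(P.q₀ : ℂ) ^ 2 := by
    field_simp at h0
    linear_combination h0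
  have h2 : ‖z‖ ^ 2 = P.q₀ ^ 2 := by
    have := congrArg norm h1
    simpa using this
  rw [h2]; ring

theorem gam_ne_zero_of_mem_DMinus {z : ℂ} (hz : z ∈ P.DMinus) : P.gam z ≠ 0 :=
  gam_ne_zero (ne_zero_of_mem_DMinus hz) hz.ne

theorem gam_ne_zero_of_mem_DPlus {z : ℂ} (hz : z ∈ P.DPlus) : P.gam z ≠ 0 :=
  gam_ne_zero (ne_zero_of_mem_DPlus hz) hz.ne'

variable (P)

theorem isOpen_DMinus : IsOpen P.DMinus :=
  isOpen_lt (by fun_prop) continuous_const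

theorem isOpen_DPlus : IsOpen P.DPlus :=
  isOpen_lt continuous_const (by fun_prop)

theorem qPlus_mul_conj : P.qPlus * conj P.qPlus = (P.q₀ : ℂ) ^ 2 := by
  rw [Complex.mul_conj', P.norm_qPlus]

theorem qMinus_mul_conj : P.qMinus * conj P.qMinus = (P.q₀ : ℂ) ^ 2 := by
  rw [Complex.mul_conj', P.norm_qMinus]

theorem q₀_ne_zero : (P.q₀ : ℂ) ≠ 0 := by exact_mod_cast P.q₀_pos.ne'

theorem qPlus_ne_zero : P.qPlus ≠ 0 := norm_ne_zero_iff.1 (by rw [P.norm_qPlus]; exact P.q₀_pos.ne')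

theorem qMinus_ne_zero : P.qMinus ≠ 0 :=
  norm_ne_zero_iff.1 (by rw [P.norm_qMinus]; exact P.q₀_pos.ne')

/-- `X + iλ` with `q` replaced by its limit at `+∞`. -/
noncomputable def limX (z : ℂ) : (Fin 2 → ℂ) →L[ℂ] (Fin 2 → ℂ) :=
  mvC !![I * (P.q₀ ^ 2 / z), P.qPlus; -conj P.qPlus, I * z]

/-- The deviation of `X` at `t = 0` from its limit at `+∞`. -/
noncomputable def devX (x : ℝ) : (Fin 2 → ℂ) →L[ℂ] (Fin 2 → ℂ) :=
  mvC !![0, P.q x 0 - P.qPlus; -conj (P.q x 0 - P.qPlus), 0]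

/-- The first column of `Y_+`. -/
noncomputable def limCol (z : ℂ) : Fin 2 → ℂ := fun i => Y P.qPlus z i 0

theorem limCol_eq (z : ℂ) : P.limCol z = ![1, -(I * conj P.qPlus / z)] := by
  ext i; fin_cases i <;> rfl

theorem limX_add_devX (x : ℝ) (z : ℂ) :
    P.limX z + P.devX x = mvC (P.laxX x 0 z) + (I * P.lam z) • 1 := by
  have h1 : (1 : (Fin 2 → ℂ) →L[ℂ] (Fin 2 → ℂ)) = mvC 1 :=
    ContinuousLinearMap.ext fun v => by simp
  rw [limX, devX, h1, ← mvC_smul, ← mvC_add, ← mvC_add, laxX_eq]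
  congr 1
  ext i j
  fin_cases i <;> fin_cases j <;> simp [k, lam] <;> ring

/-- Cayley–Hamilton: the matrix has determinant `|q_+|² - q₀² = 0` and trace `2iλ`. -/
theorem limX_mul_self (z : ℂ) (hz : z ≠ 0) :
    P.limX z * P.limX z = (2 * I * P.lam z) • P.limX z := by
  have h := P.qPlus_mul_conj
  rw [limX, ← mvC_smul, ← mvC_mul]
  congr 1
  ext i j
  fin_cases i <;> fin_cases j <;> simp [lam] <;> field_simp
  · linear_combination (-z ^ 2) * h - (P.q₀ : ℂ) ^ 2 * z ^ 2 * I_sq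
  · ring
  · ring
  · linear_combination (-1 : ℂ) * h - (P.q₀ : ℂ) ^ 2 * I_sq

theorem limX_limCol (z : ℂ) (hz : z ≠ 0) : P.limX z (P.limCol z) = 0 := by
  have h := P.qPlus_mul_conj
  ext i
  fin_cases i <;> simp [limX, limCol_eq] <;> field_simp
  · linear_combination -I * h
  · simp only [I_sq]; ring

theorem continuous_devX : Continuous P.devX := by
  have := P.continuous_q_x 0
  exact continuous_mvC continuous_const (by fun_prop) (by fun_prop) continuous_const

theorem integrableOn_devX : IntegrableOn P.devX (Set.Ici 0) := by
  refine Integrable.mono' ((P.integrable_plus 0).norm.const_mul 2)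
    P.continuous_devX.aestronglyMeasurable (Eventually.of_forall fun x => ?_)
  refine (norm_mvC_le _ _ _ _).trans (le_of_eq ?_)
  rw [norm_neg, RCLike.norm_conj]
  simp; ring

theorem differentiableAt_limX {z : ℂ} (hz : z ≠ 0) : DifferentiableAt ℂ P.limX z := by
  have h : P.limX = fun z => (I * (P.q₀ ^ 2 / z)) • mvC !![1, 0; 0, 0] + P.qPlus • mvC !![0, 1; 0, 0]
      + (-conj P.qPlus) • mvC !![0, 0; 1, 0] + (I * z) • mvC !![0, 0; 0, 1] :=
    funext fun z => mvC_entries _ _ _ _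
  rw [h]
  fun_prop (disch := assumption)

theorem differentiableAt_limCol {z : ℂ} (hz : z ≠ 0) : DifferentiableAt ℂ P.limCol z := by
  rw [differentiableAt_pi]
  intro i
  fin_cases i <;> simp [limCol, Y]
  fun_prop (disch := assumption)

theorem differentiableAt_lam {z : ℂ} (hz : z ≠ 0) : DifferentiableAt ℂ P.lam z := by
  unfold lam; fun_prop (disch := assumption)

theorem re_two_I_lam_pos {z : ℂ} (hz : z ∈ P.DMinus) : 0 < (2 * I * P.lam z).re := by
  have hz0 := ne_zero_of_mem_DMinus hz
  have h : (2 * I * P.lam z).re = -2 * (P.lam z).im := by simp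
  rw [h, lam_im P z hz0]
  have h1 : (‖z‖ ^ 2 - P.q₀ ^ 2) * z.im / (2 * ‖z‖ ^ 2) < 0 :=
    div_neg_of_neg_of_pos hz (by positivity)
  linarith

theorem theta_zero (x : ℝ) (z : ℂ) : P.theta x 0 z = P.lam z * x := by simp [theta]

/-- `e^{iλx} φ` solves the normalised equation when `φ` solves the `x`-equation. -/
theorem hasDerivAt_exp_smul {z : ℂ} {φ : ℝ → Fin 2 → ℂ} {x : ℝ}
    (hφ : HasDerivAt φ (P.laxX x 0 z *ᵥ φ x) x) :
    HasDerivAt (fun x : ℝ => exp (I * P.lam z * x) • φ x)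
      ((P.limX z + P.devX x) (exp (I * P.lam z * x) • φ x)) x := by
  have hd : HasDerivAt (fun y : ℝ => exp (I * P.lam z * y))
      (I * P.lam z * exp (I * P.lam z * x)) x := by
    have := (((hasDerivAt_id x).ofReal_comp).const_mul (I * P.lam z)).cexp
    simpa [mul_comm] using! this
  have hX : ∀ v, (P.limX z + P.devX x) v = P.laxX x 0 z *ᵥ v + (I * P.lam z) • v := fun v => by
    rw [P.limX_add_devX x z]; rfl
  rw [hX]
  convert! hd.smul hφ using 1
  rw [Matrix.mulVec_smul]
  module

theorem tendsto_laxT (t : ℝ) (z : ℂ) :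
    Tendsto (fun p : ℝ × ℝ => mvC (P.laxT p.1 p.2 z)) (atTop ×ˢ 𝓝 t)
      (𝓝 (mvC !![-(I * P.k z ^ 2), P.k z * P.qPlus; -(P.k z * conj P.qPlus), I * P.k z ^ 2])) := by
  have h1 := P.tendsto_plus t
  have h1' := (Complex.continuous_conj.tendsto _).comp h1
  have h2 : Tendsto (fun p : ℝ × ℝ => P.qx p.1 p.2) (atTop ×ˢ 𝓝 t) (𝓝 0) := P.tendsto_x_plus t
  have h2' := (Complex.continuous_conj.tendsto _).comp h2
  have hm := h1.mul h1'
  have h3 := (hm.const_sub ((P.q₀ : ℂ) ^ 2)).const_mul (I / 2)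
  have ha := h3.const_sub (-(I * P.k z ^ 2))
  have hb := (h1.const_mul (P.k z)).add (h2.const_mul (I / 2))
  have hc := (h1'.const_mul (P.k z)).neg.add (h2'.const_mul (I / 2))
  have hd := h3.const_add (I * P.k z ^ 2)
  have key := (((ha.smul_const (mvC !![1, 0; 0, 0])).add (hb.smul_const (mvC !![0, 1; 0, 0]))).add
    (hc.smul_const (mvC !![0, 0; 1, 0]))).add (hd.smul_const (mvC !![0, 0; 0, 1]))
  rw [P.qPlus_mul_conj, map_zero, mul_zero, sub_self, mul_zero, sub_zero, add_zero, add_zero,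
    add_zero, ← mvC_entries] at key
  exact key.congr fun p => (mvC_entries _ _ _ _).symm.trans (congrArg mvC (P.laxT_eq p.1 p.2 z).symm)

/-- Convergence near each time is made uniform on `|s| ≤ R` by compactness. -/
theorem eventually_laxT_close (R : ℝ) (z : ℂ) {ε : ℝ} (hε : 0 < ε) :
    ∀ᶠ x in (atTop : Filter ℝ), ∀ s : ℝ, |s| ≤ R → ‖mvC (P.laxT x s z) -
      mvC !![-(I * P.k z ^ 2), P.k z * P.qPlus; -(P.k z * conj P.qPlus), I * P.k z ^ 2]‖ < ε := by
  have h := (isCompact_closedBall (0 : ℝ) R).mem_prod_nhdsSet_of_forall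
    (fun s _ => (P.tendsto_laxT s z).eventually (Metric.ball_mem_nhds _ hε))
  have h2 := Filter.Eventually.curry (p := fun p : ℝ × ℝ => mvC (P.laxT p.1 p.2 z) ∈ Metric.ball
      (mvC !![-(I * P.k z ^ 2), P.k z * P.qPlus; -(P.k z * conj P.qPlus), I * P.k z ^ 2]) ε) h
  filter_upwards [h2] with x hx s hs
  simpa [dist_eq_norm] using! hx.self_of_nhdsSet s (by simpa using hs)

/-- The normalisation at `t = 0` propagates to all times. -/
theorem IsSol.tendsto_of_tendsto_zero {P : NZBCPotential} {z : ℂ} (hz : z ≠ 0)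
    {ψ : ℝ → ℝ → Fin 2 → ℂ} (hψ : P.IsSol z ψ)
    (h0 : Tendsto (fun x : ℝ => exp (I * P.theta x 0 z) • ψ x 0) atTop (𝓝 (P.limCol z))) (t : ℝ) :
    Tendsto (fun x : ℝ => exp (I * P.theta x t z) • ψ x t) atTop (𝓝 (P.limCol z)) := by
  set T := mvC !![-(I * P.k z ^ 2), P.k z * P.qPlus; -(P.k z * conj P.qPlus), I * P.k z ^ 2] with hT
  set e := P.limCol z
  set c := I * (P.lam z * P.k z) with hc
  have hTe : T e + c • e = 0 := by
    have h := P.limX_limCol z hz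
    -- In the limit the `t`-equation is `k` times the `x`-equation after removing the phases: `T +
    -- iλk = k (X + iλ)`, so both annihilate `e`.
    have hT' : T + c • 1 = P.k z • P.limX z := by
      have h1 : (1 : (Fin 2 → ℂ) →L[ℂ] (Fin 2 → ℂ)) = mvC 1 :=
        ContinuousLinearMap.ext fun v => by simp
      rw [limX, h1, hT, ← mvC_smul, ← mvC_smul, ← mvC_add]
      congr 1
      ext i j
      fin_cases i <;> fin_cases j <;> simp [hc, k, lam] <;> field_simp <;> ring
    have := DFunLike.congr_fun hT' e
    rw [smul_apply, h, smul_zero] at this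
    exact this
  have hder : ∀ x s : ℝ, HasDerivAt (fun s => exp (I * P.theta x s z) • ψ x s - e)
      (mvC (P.laxT x s z) (exp (I * P.theta x s z) • ψ x s) + c • (exp (I * P.theta x s z) • ψ x s)) s := by
    intro x s
    have h1 : HasDerivAt (fun s : ℝ => I * P.theta x s z) c s := by
      have := ((((hasDerivAt_id s).ofReal_comp).const_mul (P.k z)).const_add (x : ℂ)).const_mul (P.lam z)
      have := this.const_mul I
      simpa [hc] using! this
    have := (h1.cexp.smul (hψ.2 x s)).sub_const e
    convert! this using 1
    rw [mvC_apply, Matrix.mulVec_smul]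
    module
  set K := Real.exp ((‖T + c • 1‖ + 1 + 1) * |t|)
  rw [tendsto_iff_norm_sub_tendsto_zero] at h0 ⊢
  rw [Metric.tendsto_nhds]
  intro δ hδ
  obtain ⟨ε, hε, hε1, hεδ⟩ : ∃ ε : ℝ, 0 < ε ∧ ε ≤ 1 ∧ (ε + ε * ‖e‖) * K < δ := by
    have h1 : Tendsto (fun ε : ℝ => (ε + ε * ‖e‖) * K) (𝓝[>] 0) (𝓝 0) := by
      have : Continuous fun ε : ℝ => (ε + ε * ‖e‖) * K := by fun_prop
      simpa using (this.tendsto 0).mono_left nhdsWithin_le_nhds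
    have h2 : ∀ᶠ ε : ℝ in 𝓝[>] 0, ε ≤ 1 :=
      nhdsWithin_le_nhds (ge_mem_nhds (by norm_num))
    have h3 : ∀ᶠ ε : ℝ in 𝓝[>] 0, 0 < ε := self_mem_nhdsWithin
    obtain ⟨ε, h1, h2, h3⟩ := ((h1.eventually (gt_mem_nhds hδ)).and (h2.and h3)).exists
    exact ⟨ε, h3, h2, h1⟩
  filter_upwards [h0.eventually (ge_mem_nhds hε), P.eventually_laxT_close |t| z hε] with x hx hTx
  -- Since `T e + c e = 0`, the deviation from `e` is forced only by `(laxT - T) e`, of norm at most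
  -- `ε ‖e‖`. The `+ 1` in the rate absorbs `‖laxT - T‖ ≤ ε ≤ 1`.
  have := LinearODE.norm_le_of_norm_deriv_le (s₀ := 0) (R := |t|) (C := ‖T + c • 1‖ + 1) (δ := ε)
    (ε := ε * ‖e‖) (by positivity) hε.le (by positivity) (fun s _ => hder x s) (fun s hs => by
      have hs' := (hTx s (by simpa using hs)).le
      set f := exp (I * P.theta x s z) • ψ x s with hf
      have e1 : mvC (P.laxT x s z) f + c • f =
          (T + c • 1) (f - e) + (mvC (P.laxT x s z) - T) (f - e) + (mvC (P.laxT x s z) - T) e := by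
        have e2 : mvC (P.laxT x s z) f + c • f = mvC (P.laxT x s z) f + c • f - (T e + c • e) := by
          rw [hTe, sub_zero]
        rw [e2]
        simp only [add_apply, sub_apply, smul_apply, one_apply_eq_self, map_sub]
        abel
      rw [e1]
      refine (norm_add_le _ _).trans (add_le_add ((norm_add_le _ _).trans ?_) ?_)
      · rw [add_mul]
        gcongr
        · exact ContinuousLinearMap.le_opNorm _ _
        · exact (ContinuousLinearMap.le_opNorm _ _).trans (by gcongr; linarith)
      · exact (ContinuousLinearMap.le_opNorm _ _).trans (by gcongr)) hx (s := t) (by simp)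
  rw [dist_zero_right, norm_norm]
  exact this.trans_lt hεδ

theorem isJostColumn_zero_iff {l : Filter ℝ} {a z : ℂ} {ψ : ℝ → ℝ → Fin 2 → ℂ} :
    P.IsJostColumn l a 0 z ψ ↔ P.IsSol z ψ ∧ ∀ t : ℝ,
      Tendsto (fun x => exp (I * P.theta x t z) • ψ x t) l (𝓝 (fun i => Y a z i 0)) := by
  simp [IsJostColumn, IsSol, phase, and_assoc]

/-- Existence and holomorphic dependence of the Jost column `ψ_{+,1}` on `D⁻`. -/
theorem exists_isJostColumn_plus {z₀ : ℂ} (hz₀ : z₀ ∈ P.DMinus) :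
    ∃ ψ : ℂ → ℝ → ℝ → Fin 2 → ℂ, (∀ x t, DifferentiableAt ℂ (fun z => ψ z x t) z₀) ∧
      ∀ᶠ z in 𝓝 z₀, P.IsJostColumn atTop P.qPlus 0 z (ψ z) := by
  have h0 : ∀ z ∈ P.DMinus, z ≠ 0 := fun z hz => ne_zero_of_mem_DMinus hz
  obtain ⟨χ, x₀, hd, hχ⟩ := LinearODE.exists_solution_tendsto (M := P.limX)
    (μ := fun z => 2 * I * P.lam z) (e := P.limCol) (W := P.devX) P.isOpen_DMinus
    (fun z hz => (P.differentiableAt_limX (h0 z hz)).differentiableWithinAt)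
    (fun z hz => ((P.differentiableAt_lam (h0 z hz)).continuousAt.const_mul _).continuousWithinAt)
    (fun z hz => (P.differentiableAt_limCol (h0 z hz)).differentiableWithinAt)
    (fun z hz => P.limX_mul_self z (h0 z hz)) (fun z hz => P.re_two_I_lam_pos hz)
    (fun z hz => P.limX_limCol z (h0 z hz)) P.continuous_devX P.integrableOn_devX hz₀
  -- The initial value at `(x₀, 0)` is chosen so that `e^{iλx} ψ` and `χ` agree at `x₀`, hence along
  -- `t = 0`.
  choose ψ hψ0 hψ using fun z => P.exists_isSol z x₀ (exp (-(I * P.lam z * x₀)) • χ z x₀)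
  refine ⟨ψ, differentiableAt_of_isSol (h0 z₀ hz₀) (Eventually.of_forall hψ) (x₀ := x₀) ?_, ?_⟩
  · simp only [hψ0]
    have := P.differentiableAt_lam (h0 z₀ hz₀)
    exact ((this.const_mul I).mul_const _).neg.cexp.smul hd
  filter_upwards [hχ, P.isOpen_DMinus.mem_nhds hz₀] with z hz hzD
  have hz0 := h0 z hzD
  rw [isJostColumn_zero_iff]
  refine ⟨hψ z, (hψ z).tendsto_of_tendsto_zero hz0 ?_⟩
  have he : (fun x : ℝ => exp (I * P.lam z * x) • ψ z x 0) = χ z := by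
    refine LinearODE.solution_unique (A := fun x => P.limX z + P.devX x) (s₀ := x₀) ?_ ?_ hz.1 ?_
    · have := P.continuous_devX
      fun_prop
    · exact fun x => P.hasDerivAt_exp_smul ((hψ z).1 x 0)
    · simp [hψ0, smul_smul, ← Complex.exp_add]
  have := hz.2
  rw [← he] at this
  refine this.congr fun x => ?_
  rw [theta_zero, mul_assoc]

/-- Uniqueness of the Jost column `ψ_{+,1}` on `D⁻`. -/
theorem isJostColumn_plus_unique {z : ℂ} (hz : z ∈ P.DMinus) {ψ φ : ℝ → ℝ → Fin 2 → ℂ}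
    (hψ : P.IsJostColumn atTop P.qPlus 0 z ψ) (hφ : P.IsJostColumn atTop P.qPlus 0 z φ) : ψ = φ := by
  rw [isJostColumn_zero_iff] at hψ hφ
  have hz0 := ne_zero_of_mem_DMinus hz
  have hd : ∀ x, HasDerivAt (fun x => ψ x 0 - φ x 0) (P.laxX x 0 z *ᵥ (ψ x 0 - φ x 0)) x :=
    fun x => by rw [Matrix.mulVec_sub]; exact (hψ.1.1 x 0).sub (hφ.1.1 x 0)
  have ht := (hψ.2 0).sub (hφ.2 0)
  rw [sub_self] at ht
  have := LinearODE.eq_zero_of_tendsto_zero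
    (χ := fun x : ℝ => exp (I * P.lam z * x) • (ψ x 0 - φ x 0)) P.continuous_devX
    P.integrableOn_devX (P.limX_mul_self z hz0) (P.re_two_I_lam_pos hz)
    (fun x => P.hasDerivAt_exp_smul (hd x))
    (ht.congr fun x => by rw [theta_zero, smul_sub, mul_assoc])
  refine hψ.1.eq_of_eq hφ.1 (x₀ := 0) ?_
  have := congrFun this 0
  simpa [sub_eq_zero] using this

end NZBCPotential

end KunduEckhaus

/-! ### Symmetries of the Lax pair, and the three remaining Jost columns. -/

namespace KunduEckhaus

/-- The conjugate-linear map `(u, v) ↦ (-v*, u*)`. -/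
noncomputable def conjTwist (v : Fin 2 → ℂ) : Fin 2 → ℂ := ![-conj (v 1), conj (v 0)]

theorem conjTwist_smul (c : ℂ) (v : Fin 2 → ℂ) : conjTwist (c • v) = conj c • conjTwist v := by
  ext i; fin_cases i <;> simp [conjTwist]

theorem conjTwist_add (v w : Fin 2 → ℂ) : conjTwist (v + w) = conjTwist v + conjTwist w := by
  ext i; fin_cases i <;> simp [conjTwist]; ring

theorem conjTwist_conjTwist (v : Fin 2 → ℂ) : conjTwist (conjTwist v) = -v := by
  ext i; fin_cases i <;> simp [conjTwist]

theorem continuous_conjTwist : Continuous conjTwist := by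
  unfold conjTwist
  refine continuous_pi fun i => ?_
  fin_cases i <;> simp <;> fun_prop

theorem hasDerivAt_conjTwist {f : ℝ → Fin 2 → ℂ} {f' : Fin 2 → ℂ} {x : ℝ} (h : HasDerivAt f f' x) :
    HasDerivAt (fun x => conjTwist (f x)) (conjTwist f') x := by
  rw [hasDerivAt_pi] at h ⊢
  intro i
  fin_cases i
  · exact (hasDerivAt_conj (h 1)).neg
  · exact hasDerivAt_conj (h 0)

theorem hasDerivAt_conjTwist_conj {f : ℂ → Fin 2 → ℂ} {f' : Fin 2 → ℂ} {z : ℂ}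
    (h : HasDerivAt f f' z) :
    HasDerivAt (fun w => conjTwist (f (conj w))) (conjTwist f') (conj z) := by
  rw [hasDerivAt_pi] at h ⊢
  intro i
  fin_cases i
  · exact (h 1).conj_conj.neg
  · exact (h 0).conj_conj

namespace NZBCPotential

variable {P : NZBCPotential}

theorem k_conj (z : ℂ) : P.k (conj z) = conj (P.k z) := by simp [k, map_ofNat]

theorem lam_conj (z : ℂ) : P.lam (conj z) = conj (P.lam z) := by simp [lam, map_ofNat]

theorem theta_conj (x t : ℝ) (z : ℂ) : P.theta x t (conj z) = conj (P.theta x t z) := by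
  simp [theta, k_conj, lam_conj]

theorem gam_conj (z : ℂ) : P.gam (conj z) = conj (P.gam z) := by simp [gam]

/-- For real `k` both Lax matrices lie in `su(2)`, whose elements commute with the twist. For
complex `k`, moving the twist past them conjugates `k`. -/
theorem IsSol.conjTwist {z : ℂ} {ψ : ℝ → ℝ → Fin 2 → ℂ} (h : P.IsSol z ψ) :
    P.IsSol (conj z) (fun x t => conjTwist (ψ x t)) := by
  constructor
  · intro x t
    convert hasDerivAt_conjTwist (h.1 x t) using 1
    rw [laxX_eq, laxX_eq, k_conj]
    ext i
    fin_cases i <;> simp [KunduEckhaus.conjTwist, Matrix.vecHead, Matrix.vecTail] <;> ring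
  · intro x t
    convert hasDerivAt_conjTwist (h.2 x t) using 1
    rw [laxT_eq, laxT_eq, k_conj]
    ext i
    fin_cases i <;> simp [KunduEckhaus.conjTwist, Matrix.vecHead, Matrix.vecTail, map_ofNat] <;> ring

theorem isJostColumn_one_iff {l : Filter ℝ} {a z : ℂ} {ψ : ℝ → ℝ → Fin 2 → ℂ} :
    P.IsJostColumn l a 1 z ψ ↔ P.IsSol z ψ ∧ ∀ t : ℝ,
      Tendsto (fun x => exp (-(I * P.theta x t z)) • ψ x t) l (𝓝 (fun i => Y a z i 1)) := by
  simp [IsJostColumn, IsSol, phase, and_assoc]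

theorem IsJostColumn.isSol {l : Filter ℝ} {a z : ℂ} {j : Fin 2} {ψ : ℝ → ℝ → Fin 2 → ℂ}
    (h : P.IsJostColumn l a j z ψ) : P.IsSol z ψ := ⟨h.1, h.2.1⟩

theorem IsJostColumn.conjTwist {l : Filter ℝ} {a z : ℂ} {ψ : ℝ → ℝ → Fin 2 → ℂ}
    (h : P.IsJostColumn l a 0 z ψ) :
    P.IsJostColumn l a 1 (conj z) (fun x t => conjTwist (ψ x t)) := by
  rw [isJostColumn_zero_iff] at h
  rw [isJostColumn_one_iff]
  refine ⟨h.1.conjTwist, fun t => ?_⟩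
  have := (continuous_conjTwist.tendsto _).comp (h.2 t)
  have e : KunduEckhaus.conjTwist (fun i => Y a z i 0) = fun i => Y a (conj z) i 1 := by
    ext i; fin_cases i <;> simp [KunduEckhaus.conjTwist, Y, neg_div]
  rw [e] at this
  refine this.congr fun x => ?_
  simp only [Function.comp_apply]
  rw [conjTwist_smul, ← Complex.exp_conj, theta_conj]
  simp

/-- The involution `z ↦ -q₀²/z`. -/
noncomputable def hat (P : NZBCPotential) (z : ℂ) : ℂ := -(P.q₀ : ℂ) ^ 2 / z

theorem hat_ne_zero {z : ℂ} (hz : z ≠ 0) : P.hat z ≠ 0 :=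
  div_ne_zero (neg_ne_zero.2 (pow_ne_zero _ P.q₀_ne_zero)) hz

theorem hat_hat (z : ℂ) : P.hat (P.hat z) = z := by
  have h := P.q₀_ne_zero
  rcases eq_or_ne z 0 with rfl | hz
  · simp [hat]
  · unfold hat; field_simp

theorem k_hat {z : ℂ} (hz : z ≠ 0) : P.k (P.hat z) = P.k z := by
  have h := P.q₀_ne_zero
  unfold hat k; field_simp; ring

theorem lam_hat {z : ℂ} (hz : z ≠ 0) : P.lam (P.hat z) = -P.lam z := by
  have h := P.q₀_ne_zero
  unfold hat lam; field_simp; ring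

theorem theta_hat (x t : ℝ) {z : ℂ} (hz : z ≠ 0) : P.theta x t (P.hat z) = -P.theta x t z := by
  simp [theta, k_hat hz, lam_hat hz]

theorem gam_hat {z : ℂ} (hz : z ≠ 0) : P.gam (P.hat z) = z ^ 2 / P.q₀ ^ 2 * P.gam z := by
  have h := P.q₀_ne_zero
  unfold hat gam; field_simp; ring

theorem mem_DPlus_iff_lam {z : ℂ} (hz : z ≠ 0) : z ∈ P.DPlus ↔ 0 < (P.lam z).im := by
  have h : 0 < 2 * ‖z‖ ^ 2 := by have := norm_pos_iff.2 hz; positivity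
  rw [lam_im P z hz, lt_div_iff₀ h, zero_mul]; rfl

theorem mem_DMinus_iff_lam {z : ℂ} (hz : z ≠ 0) : z ∈ P.DMinus ↔ (P.lam z).im < 0 := by
  have h : 0 < 2 * ‖z‖ ^ 2 := by have := norm_pos_iff.2 hz; positivity
  rw [lam_im P z hz, div_lt_iff₀ h, zero_mul]; rfl

theorem hat_mem_DMinus {z : ℂ} (hz : z ∈ P.DPlus) : P.hat z ∈ P.DMinus := by
  have hz0 := ne_zero_of_mem_DPlus hz
  rw [mem_DMinus_iff_lam (hat_ne_zero hz0), lam_hat hz0, neg_im]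
  linarith [(mem_DPlus_iff_lam hz0).1 hz]

theorem hat_mem_DPlus {z : ℂ} (hz : z ∈ P.DMinus) : P.hat z ∈ P.DPlus := by
  have hz0 := ne_zero_of_mem_DMinus hz
  rw [mem_DPlus_iff_lam (hat_ne_zero hz0), lam_hat hz0, neg_im]
  linarith [(mem_DMinus_iff_lam hz0).1 hz]

theorem conj_mem_DPlus {z : ℂ} (hz : z ∈ P.DMinus) : conj z ∈ P.DPlus := by
  have : (‖z‖ ^ 2 - P.q₀ ^ 2) * z.im < 0 := hz
  simp only [DPlus, Set.mem_ofPred_eq, RCLike.norm_conj, conj_im]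
  linarith

theorem conj_mem_DMinus {z : ℂ} (hz : z ∈ P.DPlus) : conj z ∈ P.DMinus := by
  have : 0 < (‖z‖ ^ 2 - P.q₀ ^ 2) * z.im := hz
  simp only [DMinus, Set.mem_ofPred_eq, RCLike.norm_conj, conj_im]
  linarith

theorem hasDerivAt_hat {z : ℂ} (hz : z ≠ 0) : HasDerivAt P.hat ((P.q₀ : ℂ) ^ 2 / z ^ 2) z := by
  have := (hasDerivAt_inv hz).const_mul (-(P.q₀ : ℂ) ^ 2)
  convert! this using 1
  field_simp

/-- The Lax matrices see `z` only through `k`, so `z` and `-q₀²/z` share their solutions; only the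
normalisation distinguishes them. -/
theorem IsSol.of_k_eq {z w : ℂ} (h : P.k z = P.k w) {ψ : ℝ → ℝ → Fin 2 → ℂ} (hψ : P.IsSol z ψ) :
    P.IsSol w ψ := by
  constructor
  · intro x t
    have := hψ.1 x t
    rwa [laxX_eq, h, ← laxX_eq] at this
  · intro x t
    have := hψ.2 x t
    rwa [laxT_eq, h, ← laxT_eq] at this

/-- As `λ` changes sign under `hat`, the phase becomes that of the other column. The scalar `-ia/z`
takes the first column of `Y` at `hat z` to its second column at `z`, by `|a|² = q₀²`. -/
theorem IsJostColumn.of_hat_zero {l : Filter ℝ} {a z : ℂ} (hz : z ≠ 0)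
    (ha : a * conj a = (P.q₀ : ℂ) ^ 2) {ψ : ℝ → ℝ → Fin 2 → ℂ}
    (h : P.IsJostColumn l a 0 (P.hat z) ψ) :
    P.IsJostColumn l a 1 z (fun x t => (-(I * a / z)) • ψ x t) := by
  have hq := P.q₀_ne_zero
  rw [isJostColumn_zero_iff] at h
  rw [isJostColumn_one_iff]
  refine ⟨(h.1.of_k_eq (k_hat hz)).smul _, fun t => ?_⟩
  have := (h.2 t).const_smul (-(I * a / z))
  have e : (-(I * a / z)) • (fun i => Y a (P.hat z) i 0) = fun i => Y a z i 1 := by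
    ext i; fin_cases i <;> simp [Y, hat]
    field_simp
    linear_combination I ^ 2 * (-1) * ha - (P.q₀ : ℂ) ^ 2 * I_sq
  rw [e] at this
  refine this.congr fun x => ?_
  rw [theta_hat x t hz, smul_comm]
  simp

theorem IsJostColumn.of_hat_one {l : Filter ℝ} {a z : ℂ} (hz : z ≠ 0)
    (ha : a * conj a = (P.q₀ : ℂ) ^ 2) {ψ : ℝ → ℝ → Fin 2 → ℂ}
    (h : P.IsJostColumn l a 1 (P.hat z) ψ) :
    P.IsJostColumn l a 0 z (fun x t => (-(I * conj a / z)) • ψ x t) := by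
  have hq := P.q₀_ne_zero
  rw [isJostColumn_one_iff] at h
  rw [isJostColumn_zero_iff]
  refine ⟨(h.1.of_k_eq (k_hat hz)).smul _, fun t => ?_⟩
  have := (h.2 t).const_smul (-(I * conj a / z))
  have e : (-(I * conj a / z)) • (fun i => Y a (P.hat z) i 1) = fun i => Y a z i 0 := by
    ext i; fin_cases i <;> simp [Y, hat]
    field_simp
    linear_combination I ^ 2 * (-1) * ha - (P.q₀ : ℂ) ^ 2 * I_sq
  rw [e] at this
  refine this.congr fun x => ?_
  rw [theta_hat x t hz, smul_comm]
  simp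

/-- On `D`, the Jost column normalised at the end `l` exists, is unique and is holomorphic. -/
def JostRegular (P : NZBCPotential) (l : Filter ℝ) (a : ℂ) (j : Fin 2) (D : Set ℂ) : Prop :=
  (∀ z₀ ∈ D, ∃ ψ : ℂ → ℝ → ℝ → Fin 2 → ℂ, (∀ x t, DifferentiableAt ℂ (fun z => ψ z x t) z₀) ∧
      ∀ᶠ z in 𝓝 z₀, P.IsJostColumn l a j z (ψ z)) ∧
    ∀ z ∈ D, ∀ ψ φ : ℝ → ℝ → Fin 2 → ℂ,
      P.IsJostColumn l a j z ψ → P.IsJostColumn l a j z φ → ψ = φ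

theorem jostRegular_plus_zero (P : NZBCPotential) : P.JostRegular atTop P.qPlus 0 P.DMinus :=
  ⟨fun _ hz => P.exists_isJostColumn_plus hz, fun _ hz _ _ => P.isJostColumn_plus_unique hz⟩

theorem JostRegular.isJostColumn_epsilon {l : Filter ℝ} {a : ℂ} {j : Fin 2} {D : Set ℂ}
    (h : P.JostRegular l a j D) {z : ℂ} (hz : z ∈ D) :
    P.IsJostColumn l a j z (Classical.epsilon (P.IsJostColumn l a j z)) := by
  obtain ⟨ψ, -, hψ⟩ := h.1 z hz
  exact Classical.epsilon_spec (p := P.IsJostColumn l a j z) ⟨_, hψ.self_of_nhds⟩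

theorem JostRegular.differentiableAt_epsilon {l : Filter ℝ} {a : ℂ} {j : Fin 2} {D : Set ℂ}
    (h : P.JostRegular l a j D) (hD : IsOpen D) {z : ℂ} (hz : z ∈ D) (x t : ℝ) :
    DifferentiableAt ℂ (fun w => Classical.epsilon (P.IsJostColumn l a j w) x t) z := by
  obtain ⟨ψ, hd, hψ⟩ := h.1 z hz
  refine (hd x t).congr_of_eventuallyEq ?_
  filter_upwards [hψ, hD.mem_nhds hz] with w hw hwD
  rw [h.2 w hwD _ _ (h.isJostColumn_epsilon hwD) hw]

/-- Existence and holomorphy are transported by `of_hat_zero`. For uniqueness, `of_hat_one` sends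
two candidates back to first columns at `hat z`, and its scalar is nonzero. -/
theorem JostRegular.hat {l : Filter ℝ} {a : ℂ} (ha : a * conj a = (P.q₀ : ℂ) ^ 2) {D D' : Set ℂ}
    (hD : ∀ z ∈ D', P.hat z ∈ D) (hD' : ∀ z ∈ D', z ≠ 0)
    (h : P.JostRegular l a 0 D) : P.JostRegular l a 1 D' := by
  have ha0 : conj a ≠ 0 := by
    intro h0
    rw [h0, mul_zero] at ha
    exact pow_ne_zero 2 P.q₀_ne_zero ha.symm
  constructor
  · intro z₀ hz₀
    have hz0 := hD' z₀ hz₀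
    obtain ⟨ψ, hd, hψ⟩ := h.1 _ (hD z₀ hz₀)
    refine ⟨fun z x t => (-(I * a / z)) • ψ (P.hat z) x t, fun x t => ?_, ?_⟩
    · have h1 : DifferentiableAt ℂ (fun z => -(I * a / z)) z₀ := by fun_prop (disch := assumption)
      exact h1.smul ((hd x t).comp z₀ (hasDerivAt_hat hz0).differentiableAt)
    · filter_upwards [(hasDerivAt_hat hz0).continuousAt.eventually hψ, isOpen_ne.mem_nhds hz0]
        with z hz hz0
      exact hz.of_hat_zero hz0 ha
  · intro z hz ψ φ hψ hφ
    have hz0 := hD' z hz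
    have hw0 := hat_ne_zero (P := P) hz0
    rw [← hat_hat (P := P) z] at hψ hφ
    have := h.2 _ (hD z hz) _ _ (hψ.of_hat_one hw0 ha) (hφ.of_hat_one hw0 ha)
    have hc : -(I * conj a / P.hat z) ≠ 0 := by simp [ha0, hw0]
    funext x t
    exact smul_right_injective _ hc (congrFun (congrFun this x) t)

section Reflection

variable (P)

theorem deriv_reflect_x (x t : ℝ) :
    deriv (fun y => P.q (-y) t) x = -P.qx (-x) t := by
  rw [deriv_comp_neg (fun y => P.q y t)]; rfl

theorem deriv_deriv_reflect_x (x t : ℝ) :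
    deriv (deriv (fun y => P.q (-y) t)) x = P.qxx (-x) t := by
  have h : deriv (fun y => P.q (-y) t) = fun x => -P.qx (-x) t :=
    funext fun x => P.deriv_reflect_x x t
  rw [h, deriv.fun_neg, deriv_comp_neg (fun y => P.qx y t), neg_neg]; rfl

theorem tendsto_neg_prod (f : Filter ℝ) (g : Filter ℝ) (h : Tendsto (fun x : ℝ => -x) f g) (t : ℝ) :
    Tendsto (fun p : ℝ × ℝ => ((-p.1, p.2) : ℝ × ℝ)) (f ×ˢ 𝓝 t) (g ×ˢ 𝓝 t) :=
  (h.comp tendsto_fst).prodMk tendsto_snd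

/-- The potential `q(-x, t)`. -/
noncomputable def reflect : NZBCPotential where
  q₀ := P.q₀
  q := fun x t => P.q (-x) t
  qMinus := P.qPlus
  qPlus := P.qMinus
  q₀_pos := P.q₀_pos
  norm_qMinus := P.norm_qPlus
  norm_qPlus := P.norm_qMinus
  diff_t := fun x t => P.diff_t (-x) t
  diff_x := fun x t => (P.diff_x (-x) t).comp x differentiableAt_id.neg
  diff_xx := fun x t => by
    have h : deriv (fun y => P.q (-y) t) = fun x => -P.qx (-x) t :=
      funext fun x => P.deriv_reflect_x x t
    rw [h]
    exact ((P.diff_xx (-x) t).comp x differentiableAt_id.neg).neg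
  cont_t := P.cont_t.comp (f := fun p : ℝ × ℝ => (-p.1, p.2)) (by fun_prop)
  cont_x := by
    simp_rw [deriv_reflect_x]
    exact (P.continuous_qx.comp (f := fun p : ℝ × ℝ => (-p.1, p.2)) (by fun_prop)).neg
  cont_xx := by
    simp_rw [deriv_deriv_reflect_x]
    exact P.continuous_qxx.comp (f := fun p : ℝ × ℝ => (-p.1, p.2)) (by fun_prop)
  equation := fun x t => by
    rw [deriv_deriv_reflect_x]
    exact P.equation (-x) t
  tendsto_plus := fun t => (P.tendsto_minus t).comp (tendsto_neg_prod _ _ tendsto_neg_atTop_atBot t)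
  tendsto_minus := fun t => (P.tendsto_plus t).comp (tendsto_neg_prod _ _ tendsto_neg_atBot_atTop t)
  tendsto_x_plus := fun t => by
    simp_rw [deriv_reflect_x]
    simpa using! ((P.tendsto_x_minus t).comp (tendsto_neg_prod _ _ tendsto_neg_atTop_atBot t)).neg
  tendsto_x_minus := fun t => by
    simp_rw [deriv_reflect_x]
    simpa using! ((P.tendsto_x_plus t).comp (tendsto_neg_prod _ _ tendsto_neg_atBot_atTop t)).neg
  integrable_plus := fun t => by
    have := (P.integrable_minus t).comp_neg
    simpa using! this
  integrable_minus := fun t => by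
    have := (P.integrable_plus t).comp_neg
    simpa using! this

theorem reflect_qx (x t : ℝ) : P.reflect.qx x t = -P.qx (-x) t := P.deriv_reflect_x x t

theorem reflect_k (z : ℂ) : P.reflect.k (-z) = -P.k z := by
  simp only [k, reflect]; ring

theorem reflect_theta (x t : ℝ) (z : ℂ) : P.reflect.theta (-x) t (-z) = P.theta x t z := by
  simp only [theta, k, lam, reflect]; push_cast; ring

variable {P}

theorem reflect_hasDerivAt {f : ℝ → Fin 2 → ℂ} {f' : Fin 2 → ℂ} {x : ℝ} (h : HasDerivAt f f' x) :
    HasDerivAt (fun x => ![f x 0, -f x 1]) ![f' 0, -f' 1] x := by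
  rw [hasDerivAt_pi] at h ⊢
  intro i
  fin_cases i
  · exact h 0
  · exact (h 1).neg

/-- The map is `ψ ↦ σ₃ ψ(-x)`. Reversing `x` changes the sign of `X`, conjugation by `σ₃` restores
that of `Q`, and `z ↦ -z` restores that of `k`. -/
theorem IsSol.of_reflect {z : ℂ} {ψ : ℝ → ℝ → Fin 2 → ℂ} (h : P.reflect.IsSol (-z) ψ) :
    P.IsSol z (fun x t => ![ψ (-x) t 0, -ψ (-x) t 1]) := by
  constructor
  · intro x t
    have h1 := (h.1 (-x) t).scomp x (hasDerivAt_neg x)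
    convert! reflect_hasDerivAt h1 using 1
    rw [laxX_eq, laxX_eq, reflect_k]
    ext i
    fin_cases i <;> simp [reflect, Matrix.vecHead, Matrix.vecTail] <;> ring
  · intro x t
    convert! reflect_hasDerivAt (h.2 (-x) t) using 1
    rw [laxT_eq, laxT_eq, reflect_k, reflect_qx]
    ext i
    fin_cases i <;> simp [reflect, Matrix.vecHead, Matrix.vecTail] <;> ring

theorem IsJostColumn.of_reflect {l l' : Filter ℝ} (hl : Tendsto (fun x : ℝ => -x) l' l) {a z : ℂ}
    {ψ : ℝ → ℝ → Fin 2 → ℂ} (h : P.reflect.IsJostColumn l a 0 (-z) ψ) :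
    P.IsJostColumn l' a 0 z (fun x t => ![ψ (-x) t 0, -ψ (-x) t 1]) := by
  rw [isJostColumn_zero_iff] at h ⊢
  refine ⟨h.1.of_reflect, fun t => ?_⟩
  have h1 := (h.2 t).comp hl
  rw [tendsto_pi_nhds] at h1 ⊢
  intro i
  fin_cases i
  · simpa [reflect_theta, Y] using! h1 0
  · simpa [reflect_theta, Y, div_neg] using! (h1 1).neg

theorem reflect_reflect : P.reflect.reflect = P := by
  cases P; simp [reflect]

theorem JostRegular.of_reflect {l l' : Filter ℝ} (hl : Tendsto (fun x : ℝ => -x) l' l)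
    (hl' : Tendsto (fun x : ℝ => -x) l l') {a : ℂ} {D D' : Set ℂ} (hD : ∀ z ∈ D', -z ∈ D)
    (h : P.reflect.JostRegular l a 0 D) : P.JostRegular l' a 0 D' := by
  constructor
  · intro z₀ hz₀
    obtain ⟨ψ, hd, hψ⟩ := h.1 _ (hD z₀ hz₀)
    refine ⟨fun z x t => ![ψ (-z) (-x) t 0, -ψ (-z) (-x) t 1], fun x t => ?_, ?_⟩
    · have h1 := (hd (-x) t).comp z₀ differentiableAt_id.neg
      rw [differentiableAt_pi] at h1 ⊢
      intro i
      fin_cases i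
      · exact h1 0
      · exact (h1 1).neg
    · filter_upwards [continuousAt_neg.eventually hψ] with z hz
      exact hz.of_reflect hl
  · intro z hz ψ φ hψ hφ
    rw [← reflect_reflect (P := P), ← neg_neg z] at hψ hφ
    have := h.2 _ (hD z hz) _ _ (hψ.of_reflect hl') (hφ.of_reflect hl')
    funext x t
    have h1 := congrFun (congrFun this (-x)) t
    have h2 := congrFun h1 0
    have h3 := congrFun h1 1
    ext i
    fin_cases i
    · simpa using h2
    · simpa using h3

end Reflection

theorem neg_mem_DMinus {z : ℂ} (hz : z ∈ P.DPlus) : -z ∈ P.reflect.DMinus := by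
  have : 0 < (‖z‖ ^ 2 - P.q₀ ^ 2) * z.im := hz
  simp only [DMinus, Set.mem_ofPred_eq, norm_neg, neg_im, reflect]
  linarith

theorem jostRegular_minus_zero (P : NZBCPotential) : P.JostRegular atBot P.qMinus 0 P.DPlus :=
  (P.reflect.jostRegular_plus_zero).of_reflect tendsto_neg_atBot_atTop tendsto_neg_atTop_atBot
    fun _ hz => neg_mem_DMinus hz

theorem jostRegular_plus_one (P : NZBCPotential) : P.JostRegular atTop P.qPlus 1 P.DPlus :=
  P.jostRegular_plus_zero.hat P.qPlus_mul_conj (fun _ => hat_mem_DMinus)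
    fun _ => ne_zero_of_mem_DPlus

theorem jostRegular_minus_one (P : NZBCPotential) : P.JostRegular atBot P.qMinus 1 P.DMinus :=
  P.jostRegular_minus_zero.hat P.qMinus_mul_conj (fun _ => hat_mem_DPlus)
    fun _ => ne_zero_of_mem_DMinus

end NZBCPotential

end KunduEckhaus

/-! ### Linear relations at double zeros, and the transformation of the norming constants. -/

namespace KunduEckhaus

namespace NZBCPotential

theorem exists_smul_of_Wr_eq_zero {u v : Fin 2 → ℂ} (hv : v ≠ 0) (h : Wr u v = 0) :
    ∃ c : ℂ, u = c • v := by
  unfold Wr at h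
  by_cases h0 : v 0 = 0
  · have h1 : v 1 ≠ 0 := fun h1 => hv (by ext i; fin_cases i <;> simp [h0, h1])
    refine ⟨u 1 / v 1, ?_⟩
    have hu : u 0 = 0 := by
      rw [h0, mul_zero, sub_zero] at h
      exact (mul_eq_zero.1 h).resolve_right h1
    ext i
    fin_cases i <;> simp [h0, h1, hu]
  · refine ⟨u 0 / v 0, ?_⟩
    ext i
    fin_cases i <;> simp <;> field_simp
    linear_combination -h

theorem hasDerivAt_Wr {f g : ℂ → Fin 2 → ℂ} {f' g' : Fin 2 → ℂ} {z : ℂ} (hf : HasDerivAt f f' z)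
    (hg : HasDerivAt g g' z) :
    HasDerivAt (fun w => Wr (f w) (g w)) (Wr f' (g z) + Wr (f z) g') z := by
  rw [hasDerivAt_pi] at hf hg
  convert! ((hf 0).mul (hg 1)).sub ((hf 1).mul (hg 0)) using 1
  unfold Wr
  ring

variable {P : NZBCPotential}

/-- The linear relations between two holomorphic families of solutions whose Wronskian has a
zero of order at least two. -/
theorem exists_linear_relations {z₀ : ℂ} (hz : z₀ ≠ 0) {φ ψ : ℂ → ℝ → ℝ → Fin 2 → ℂ}
    (hφ : ∀ᶠ z in 𝓝 z₀, P.IsSol z (φ z)) (hψ : ∀ᶠ z in 𝓝 z₀, P.IsSol z (ψ z))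
    (hφd : ∀ x t, DifferentiableAt ℂ (fun z => φ z x t) z₀)
    (hψd : ∀ x t, DifferentiableAt ℂ (fun z => ψ z x t) z₀)
    (hφ0 : φ z₀ 0 0 ≠ 0) (hψ0 : ψ z₀ 0 0 ≠ 0) (hW : Wr (φ z₀ 0 0) (ψ z₀ 0 0) = 0)
    (hW' : HasDerivAt (fun z => Wr (φ z 0 0) (ψ z 0 0)) 0 z₀) :
    ∃ b : ℂ, b ≠ 0 ∧ (∀ x t, φ z₀ x t = b • ψ z₀ x t) ∧ ∃ d : ℂ, ∀ x t,
      deriv (fun z => φ z x t) z₀ = d • ψ z₀ x t + b • deriv (fun z => ψ z x t) z₀ := by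
  obtain ⟨b, hb⟩ := exists_smul_of_Wr_eq_zero hψ0 hW
  have hall : φ z₀ = fun x t => b • ψ z₀ x t :=
    hφ.self_of_nhds.eq_of_eq (hψ.self_of_nhds.smul b) (x₀ := 0) hb
  refine ⟨b, ?_, fun x t => congrFun (congrFun hall x) t, ?_⟩
  · rintro rfl
    exact hφ0 (by rw [hb, zero_smul])
  have hWd := (hasDerivAt_Wr (hφd 0 0).hasDerivAt (hψd 0 0).hasDerivAt).unique hW'
  set φ' := deriv (fun z => φ z 0 0) z₀ with hφ'
  set ψ' := deriv (fun z => ψ z 0 0) z₀ with hψ'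
  -- Substituting `φ = b ψ` in the derivative of the Wronskian gives `Wr (φ' - b ψ') ψ = 0`.
  obtain ⟨d, hd⟩ : ∃ d : ℂ, φ' - b • ψ' = d • ψ z₀ 0 0 := by
    refine exists_smul_of_Wr_eq_zero hψ0 ?_
    rw [hb] at hWd
    simp only [Wr, Pi.sub_apply, Pi.smul_apply, smul_eq_mul] at hWd ⊢
    linear_combination hWd
  refine ⟨d, fun x t => ?_⟩
  -- For each `z` the combination `φ - (b + d (z - z₀)) ψ` is again a solution, and by the choice of
  -- `b` and `d` it vanishes to second order in `z` at `(0, 0)`.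
  have hder : ∀ x t, HasDerivAt (fun z => φ z x t + (-(b + d * (z - z₀))) • ψ z x t)
      (deriv (fun z => φ z x t) z₀ - b • deriv (fun z => ψ z x t) z₀ - d • ψ z₀ x t) z₀ := by
    intro x t
    have h1 : HasDerivAt (fun z => -(b + d * (z - z₀))) (-d) z₀ := by
      convert! ((((hasDerivAt_id z₀).sub_const z₀).const_mul d).const_add b).neg using 1
      rw [mul_one]
    convert! (hφd x t).hasDerivAt.add (h1.smul (hψd x t).hasDerivAt) using 1
    simp only [sub_self, mul_zero, add_zero]
    module
  have h0 : HasDerivAt (fun z => φ z 0 0 + (-(b + d * (z - z₀))) • ψ z 0 0) 0 z₀ := by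
    have := hder 0 0
    rwa [← hφ', ← hψ', hd, sub_self] at this
  have key := hasDerivAt_zero_of_isSol (P := P) (x₀ := 0) hz
    (ψ := fun z x t => φ z x t + (-(b + d * (z - z₀))) • ψ z x t)
    (by filter_upwards [hφ, hψ] with z h1 h2 using h1.add (h2.smul _))
    (by simp [hb]) h0 x t
  have := (hder x t).unique key
  rw [sub_sub, sub_eq_zero] at this
  rw [this]
  abel

/-- A solution vanishing at one point vanishes identically, whereas the `j`-th entry of its
normalised limit is the diagonal entry `1` of `Y`. -/
theorem IsJostColumn.ne_zero {l : Filter ℝ} [l.NeBot] {a z : ℂ} {j : Fin 2}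
    {ψ : ℝ → ℝ → Fin 2 → ℂ} (h : P.IsJostColumn l a j z ψ) : ψ 0 0 ≠ 0 := by
  intro h0
  have hψ : ψ = fun x t => (0 : ℂ) • ψ x t := h.isSol.eq_of_eq (h.isSol.smul 0) (x₀ := 0) (by simp [h0])
  have h1 := h.2.2 0
  rw [hψ] at h1
  simp only [zero_smul, smul_zero] at h1
  have h2 := congrFun (tendsto_nhds_unique h1 tendsto_const_nhds) j
  fin_cases j <;> simp [Y] at h2

theorem isJost_psiPlus_zero {z : ℂ} (hz : z ∈ P.DMinus) :
    P.IsJostColumn atTop P.qPlus 0 z (fun x t => P.psiPlus 0 x t z) :=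
  P.jostRegular_plus_zero.isJostColumn_epsilon hz

theorem isJost_psiPlus_one {z : ℂ} (hz : z ∈ P.DPlus) :
    P.IsJostColumn atTop P.qPlus 1 z (fun x t => P.psiPlus 1 x t z) :=
  P.jostRegular_plus_one.isJostColumn_epsilon hz

theorem isJost_psiMinus_zero {z : ℂ} (hz : z ∈ P.DPlus) :
    P.IsJostColumn atBot P.qMinus 0 z (fun x t => P.psiMinus 0 x t z) :=
  P.jostRegular_minus_zero.isJostColumn_epsilon hz

theorem isJost_psiMinus_one {z : ℂ} (hz : z ∈ P.DMinus) :
    P.IsJostColumn atBot P.qMinus 1 z (fun x t => P.psiMinus 1 x t z) :=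
  P.jostRegular_minus_one.isJostColumn_epsilon hz

theorem differentiableAt_psiPlus_zero {z : ℂ} (hz : z ∈ P.DMinus) (x t : ℝ) :
    DifferentiableAt ℂ (fun w => P.psiPlus 0 x t w) z :=
  P.jostRegular_plus_zero.differentiableAt_epsilon P.isOpen_DMinus hz x t

theorem differentiableAt_psiPlus_one {z : ℂ} (hz : z ∈ P.DPlus) (x t : ℝ) :
    DifferentiableAt ℂ (fun w => P.psiPlus 1 x t w) z :=
  P.jostRegular_plus_one.differentiableAt_epsilon P.isOpen_DPlus hz x t

theorem differentiableAt_psiMinus_zero {z : ℂ} (hz : z ∈ P.DPlus) (x t : ℝ) :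
    DifferentiableAt ℂ (fun w => P.psiMinus 0 x t w) z :=
  P.jostRegular_minus_zero.differentiableAt_epsilon P.isOpen_DPlus hz x t

theorem differentiableAt_psiMinus_one {z : ℂ} (hz : z ∈ P.DMinus) (x t : ℝ) :
    DifferentiableAt ℂ (fun w => P.psiMinus 1 x t w) z :=
  P.jostRegular_minus_one.differentiableAt_epsilon P.isOpen_DMinus hz x t

theorem differentiableAt_gam {z : ℂ} (hz : z ≠ 0) : DifferentiableAt ℂ P.gam z := by
  unfold gam
  have : z ^ 2 ≠ 0 := pow_ne_zero 2 hz
  fun_prop (disch := assumption)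

theorem differentiableAt_s11 {z : ℂ} (hz : z ∈ P.DMinus) : DifferentiableAt ℂ P.s11 z :=
  (hasDerivAt_Wr (differentiableAt_psiPlus_zero hz 0 0).hasDerivAt
    (differentiableAt_psiMinus_one hz 0 0).hasDerivAt).differentiableAt.div
    (differentiableAt_gam (ne_zero_of_mem_DMinus hz)) (gam_ne_zero_of_mem_DMinus hz)

theorem differentiableAt_s22 {z : ℂ} (hz : z ∈ P.DPlus) : DifferentiableAt ℂ P.s22 z :=
  (hasDerivAt_Wr (differentiableAt_psiMinus_zero hz 0 0).hasDerivAt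
    (differentiableAt_psiPlus_one hz 0 0).hasDerivAt).differentiableAt.div
    (differentiableAt_gam (ne_zero_of_mem_DPlus hz)) (gam_ne_zero_of_mem_DPlus hz)

theorem analyticAt_s11 {z : ℂ} (hz : z ∈ P.DMinus) : AnalyticAt ℂ P.s11 z :=
  DifferentiableOn.analyticAt (fun _ hw => (differentiableAt_s11 hw).differentiableWithinAt)
    (P.isOpen_DMinus.mem_nhds hz)

theorem analyticAt_s22 {z : ℂ} (hz : z ∈ P.DPlus) : AnalyticAt ℂ P.s22 z :=
  DifferentiableOn.analyticAt (fun _ hw => (differentiableAt_s22 hw).differentiableWithinAt)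
    (P.isOpen_DPlus.mem_nhds hz)

theorem hasDerivAt_mul_gam_zero {s W : ℂ → ℂ} {z : ℂ} (hs : DifferentiableAt ℂ s z) (hz : z ≠ 0)
    (h0 : s z = 0) (h1 : deriv s z = 0) (hW : ∀ᶠ w in 𝓝 z, W w = s w * P.gam w) :
    W z = 0 ∧ HasDerivAt W 0 z := by
  refine ⟨by rw [hW.self_of_nhds, h0, zero_mul], ?_⟩
  have := hs.hasDerivAt.mul (differentiableAt_gam (P := P) hz).hasDerivAt
  rw [h0, h1, zero_mul, zero_mul, add_zero] at this
  exact this.congr_of_eventuallyEq hW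

theorem exists_minus_relations {z : ℂ} (hz : z ∈ P.DMinus) (hd : IsDoubleZero P.s11 z) :
    ∃ b : ℂ, b ≠ 0 ∧ (∀ x t, P.psiPlus 0 x t z = b • P.psiMinus 1 x t z) ∧ ∃ d : ℂ, ∀ x t,
      P.psiPlus' 0 x t z = d • P.psiMinus 1 x t z + b • P.psiMinus' 1 x t z := by
  have hz0 := ne_zero_of_mem_DMinus hz
  have hD := P.isOpen_DMinus.mem_nhds hz
  obtain ⟨hW, hW'⟩ := hasDerivAt_mul_gam_zero (P := P) (differentiableAt_s11 hz) hz0 hd.1 hd.2.1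
    (W := fun w => Wr (P.psiPlus 0 0 0 w) (P.psiMinus 1 0 0 w))
    (by
      filter_upwards [hD] with w hw
      rw [s11, div_mul_cancel₀ _ (gam_ne_zero_of_mem_DMinus hw)])
  exact exists_linear_relations (P := P) (φ := fun w x t => P.psiPlus 0 x t w)
    (ψ := fun w x t => P.psiMinus 1 x t w) hz0
    (by filter_upwards [hD] with w hw using (isJost_psiPlus_zero hw).isSol)
    (by filter_upwards [hD] with w hw using (isJost_psiMinus_one hw).isSol)
    (differentiableAt_psiPlus_zero hz) (differentiableAt_psiMinus_one hz)
    (isJost_psiPlus_zero hz).ne_zero (isJost_psiMinus_one hz).ne_zero hW hW'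

theorem exists_plus_relations {z : ℂ} (hz : z ∈ P.DPlus) (hd : IsDoubleZero P.s22 z) :
    ∃ b : ℂ, b ≠ 0 ∧ (∀ x t, P.psiPlus 1 x t z = b • P.psiMinus 0 x t z) ∧ ∃ d : ℂ, ∀ x t,
      P.psiPlus' 1 x t z = d • P.psiMinus 0 x t z + b • P.psiMinus' 0 x t z := by
  have hz0 := ne_zero_of_mem_DPlus hz
  have hD := P.isOpen_DPlus.mem_nhds hz
  -- The sign accounts for the order of columns: `s22` has `ψ_{-,1}` first, while the relation
  -- expresses `ψ_{+,2}` through `ψ_{-,1}`.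
  obtain ⟨hW, hW'⟩ := hasDerivAt_mul_gam_zero (P := P) (s := fun w => -P.s22 w)
    (differentiableAt_s22 hz).neg hz0
    (by rw [hd.1, neg_zero]) (by rw [deriv.fun_neg, hd.2.1, neg_zero])
    (W := fun w => Wr (P.psiPlus 1 0 0 w) (P.psiMinus 0 0 0 w))
    (by
      filter_upwards [hD] with w hw
      rw [s22, neg_mul, div_mul_cancel₀ _ (gam_ne_zero_of_mem_DPlus hw)]
      unfold Wr
      ring)
  exact exists_linear_relations (P := P) (φ := fun w x t => P.psiPlus 1 x t w)
    (ψ := fun w x t => P.psiMinus 0 x t w) hz0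
    (by filter_upwards [hD] with w hw using (isJost_psiPlus_one hw).isSol)
    (by filter_upwards [hD] with w hw using (isJost_psiMinus_zero hw).isSol)
    (differentiableAt_psiPlus_one hz) (differentiableAt_psiMinus_zero hz)
    (isJost_psiPlus_one hz).ne_zero (isJost_psiMinus_zero hz).ne_zero hW hW'

/-- The column `ψ_{-,2}` is nonzero, so the constant picked by `Classical.epsilon` is the only
candidate. The symmetry rules below are proved by exhibiting one. -/
theorem bMinus_eq {z b : ℂ} (hz : z ∈ P.DMinus)
    (hb : ∀ x t, P.psiPlus 0 x t z = b • P.psiMinus 1 x t z) : P.bMinus z = b := by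
  have h := Classical.epsilon_spec (p := fun b : ℂ => ∀ x t : ℝ,
    P.psiPlus 0 x t z = b • P.psiMinus 1 x t z) ⟨b, hb⟩ 0 0
  rw [hb 0 0] at h
  exact (smul_left_injective ℂ (isJost_psiMinus_one hz).ne_zero h).symm

theorem bPlus_eq {z b : ℂ} (hz : z ∈ P.DPlus)
    (hb : ∀ x t, P.psiPlus 1 x t z = b • P.psiMinus 0 x t z) : P.bPlus z = b := by
  have h := Classical.epsilon_spec (p := fun b : ℂ => ∀ x t : ℝ,
    P.psiPlus 1 x t z = b • P.psiMinus 0 x t z) ⟨b, hb⟩ 0 0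
  rw [hb 0 0] at h
  exact (smul_left_injective ℂ (isJost_psiMinus_zero hz).ne_zero h).symm

theorem dMinus_eq {z d : ℂ} (hz : z ∈ P.DMinus) (hd : ∀ x t, P.psiPlus' 0 x t z
      = d • P.psiMinus 1 x t z + P.bMinus z • P.psiMinus' 1 x t z) : P.dMinus z = d := by
  have h := Classical.epsilon_spec (p := fun d : ℂ => ∀ x t : ℝ, P.psiPlus' 0 x t z
      = d • P.psiMinus 1 x t z + P.bMinus z • P.psiMinus' 1 x t z) ⟨d, hd⟩ 0 0
  rw [hd 0 0] at h
  exact (smul_left_injective ℂ (isJost_psiMinus_one hz).ne_zero (add_right_cancel h)).symm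

theorem dPlus_eq {z d : ℂ} (hz : z ∈ P.DPlus) (hd : ∀ x t, P.psiPlus' 1 x t z
      = d • P.psiMinus 0 x t z + P.bPlus z • P.psiMinus' 0 x t z) : P.dPlus z = d := by
  have h := Classical.epsilon_spec (p := fun d : ℂ => ∀ x t : ℝ, P.psiPlus' 1 x t z
      = d • P.psiMinus 0 x t z + P.bPlus z • P.psiMinus' 0 x t z) ⟨d, hd⟩ 0 0
  rw [hd 0 0] at h
  exact (smul_left_injective ℂ (isJost_psiMinus_zero hz).ne_zero (add_right_cancel h)).symm

theorem minus_relations {z : ℂ} (hz : z ∈ P.DMinus) (hd : IsDoubleZero P.s11 z) :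
    P.bMinus z ≠ 0 ∧ ∀ x t, P.psiPlus 0 x t z = P.bMinus z • P.psiMinus 1 x t z ∧
      P.psiPlus' 0 x t z = P.dMinus z • P.psiMinus 1 x t z + P.bMinus z • P.psiMinus' 1 x t z := by
  obtain ⟨b, hb0, hb, d, hd⟩ := exists_minus_relations hz hd
  obtain rfl := bMinus_eq hz hb
  obtain rfl := dMinus_eq hz hd
  exact ⟨hb0, fun x t => ⟨hb x t, hd x t⟩⟩

theorem plus_relations {z : ℂ} (hz : z ∈ P.DPlus) (hd : IsDoubleZero P.s22 z) :
    P.bPlus z ≠ 0 ∧ ∀ x t, P.psiPlus 1 x t z = P.bPlus z • P.psiMinus 0 x t z ∧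
      P.psiPlus' 1 x t z = P.dPlus z • P.psiMinus 0 x t z + P.bPlus z • P.psiMinus' 0 x t z := by
  obtain ⟨b, hb0, hb, d, hd⟩ := exists_plus_relations hz hd
  obtain rfl := bPlus_eq hz hb
  obtain rfl := dPlus_eq hz hd
  exact ⟨hb0, fun x t => ⟨hb x t, hd x t⟩⟩

/-! ### Symmetry under complex conjugation -/

theorem psiPlus_one_conj {z : ℂ} (hz : z ∈ P.DMinus) (x t : ℝ) :
    P.psiPlus 1 x t (conj z) = conjTwist (P.psiPlus 0 x t z) :=
  congrFun (congrFun (P.jostRegular_plus_one.2 _ (conj_mem_DPlus hz) _ _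
    (isJost_psiPlus_one (conj_mem_DPlus hz)) (isJost_psiPlus_zero hz).conjTwist) x) t

/-- The twist takes first columns to second ones and squares to `-1`, so the way back carries a
minus sign; it is the source of the sign in `bPlus_conj`. -/
theorem psiMinus_zero_conj {z : ℂ} (hz : z ∈ P.DMinus) (x t : ℝ) :
    P.psiMinus 0 x t (conj z) = -conjTwist (P.psiMinus 1 x t z) := by
  have hw := conj_mem_DPlus hz
  have h := (isJost_psiMinus_zero hw).conjTwist
  rw [conj_conj] at h
  have := congrFun (congrFun (P.jostRegular_minus_one.2 _ hz _ _ (isJost_psiMinus_one hz) h) x) t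
  rw [this, conjTwist_conjTwist, neg_neg]

/-- Applying the twist to both columns conjugates their Wronskian; the sign of `psiMinus_zero_conj`
cancels the one from exchanging the columns. -/
theorem s22_conj {z : ℂ} (hz : z ∈ P.DMinus) : P.s22 (conj z) = conj (P.s11 z) := by
  rw [s22, s11, map_div₀, gam_conj, psiPlus_one_conj hz, psiMinus_zero_conj hz]
  congr 1
  simp [Wr, conjTwist]
  ring

theorem s22_eventuallyEq {w : ℂ} (hw : w ∈ P.DPlus) :
    P.s22 =ᶠ[𝓝 w] (conj ∘ P.s11 ∘ conj : ℂ → ℂ) := by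
  filter_upwards [P.isOpen_DPlus.mem_nhds hw] with v hv
  have := s22_conj (conj_mem_DMinus hv)
  rwa [conj_conj] at this

theorem iteratedDeriv_conj_conj (n : ℕ) (f : ℂ → ℂ) :
    iteratedDeriv n (conj ∘ f ∘ conj : ℂ → ℂ) = conj ∘ iteratedDeriv n f ∘ conj := by
  induction n with
  | zero => simp
  | succ n ih => rw [iteratedDeriv_succ, ih, deriv_conj_conj, iteratedDeriv_succ]

theorem iteratedDeriv_s22_conj {z : ℂ} (hz : z ∈ P.DMinus) (n : ℕ) :
    iteratedDeriv n P.s22 (conj z) = conj (iteratedDeriv n P.s11 z) := by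
  rw [(s22_eventuallyEq (conj_mem_DPlus hz)).iteratedDeriv_eq, iteratedDeriv_conj_conj]
  simp

theorem isDoubleZero_conj {z : ℂ} (hz : z ∈ P.DMinus) (hd : IsDoubleZero P.s11 z) :
    IsDoubleZero P.s22 (conj z) := by
  refine ⟨by rw [s22_conj hz, hd.1, map_zero], ?_, ?_⟩
  · rw [← iteratedDeriv_one, iteratedDeriv_s22_conj hz, iteratedDeriv_one, hd.2.1, map_zero]
  · rw [iteratedDeriv_s22_conj hz]
    simpa using hd.2.2

theorem isDoubleZero_of_conj {z : ℂ} (hz : z ∈ P.DMinus) (hd : IsDoubleZero P.s22 (conj z)) :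
    IsDoubleZero P.s11 z := by
  obtain ⟨h0, h1, h2⟩ := hd
  rw [s22_conj hz] at h0
  rw [← iteratedDeriv_one, iteratedDeriv_s22_conj hz, iteratedDeriv_one] at h1
  rw [iteratedDeriv_s22_conj hz] at h2
  exact ⟨by simpa using h0, by simpa using h1, by simpa using h2⟩

theorem psiPlus'_one_conj {z : ℂ} (hz : z ∈ P.DMinus) (x t : ℝ) :
    P.psiPlus' 1 x t (conj z) = conjTwist (P.psiPlus' 0 x t z) := by
  refine ((hasDerivAt_conjTwist_conj (differentiableAt_psiPlus_zero hz x t).hasDerivAt)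
    |>.congr_of_eventuallyEq ?_).deriv
  filter_upwards [P.isOpen_DPlus.mem_nhds (conj_mem_DPlus hz)] with v hv
  have := psiPlus_one_conj (conj_mem_DMinus hv) x t
  rwa [conj_conj] at this

theorem psiMinus'_zero_conj {z : ℂ} (hz : z ∈ P.DMinus) (x t : ℝ) :
    P.psiMinus' 0 x t (conj z) = -conjTwist (P.psiMinus' 1 x t z) := by
  refine ((hasDerivAt_conjTwist_conj (differentiableAt_psiMinus_one hz x t).hasDerivAt).neg
    |>.congr_of_eventuallyEq ?_).deriv
  filter_upwards [P.isOpen_DPlus.mem_nhds (conj_mem_DPlus hz)] with v hv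
  have := psiMinus_zero_conj (conj_mem_DMinus hv) x t
  rwa [conj_conj] at this

theorem bPlus_conj {z : ℂ} (hz : z ∈ P.DMinus) (hd : IsDoubleZero P.s11 z) :
    P.bPlus (conj z) = -conj (P.bMinus z) := by
  refine bPlus_eq (conj_mem_DPlus hz) fun x t => ?_
  rw [psiPlus_one_conj hz, psiMinus_zero_conj hz, ((minus_relations hz hd).2 x t).1, conjTwist_smul,
    smul_neg, neg_smul, neg_neg]

theorem dPlus_conj {z : ℂ} (hz : z ∈ P.DMinus) (hd : IsDoubleZero P.s11 z) :
    P.dPlus (conj z) = -conj (P.dMinus z) := by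
  refine dPlus_eq (conj_mem_DPlus hz) fun x t => ?_
  rw [bPlus_conj hz hd, psiPlus'_one_conj hz, psiMinus_zero_conj hz, psiMinus'_zero_conj hz,
    ((minus_relations hz hd).2 x t).2, conjTwist_add, conjTwist_smul, conjTwist_smul]
  simp only [smul_neg, neg_smul, neg_neg]

theorem AMinus_eq_conj {z : ℂ} (hz : z ∈ P.DMinus) (hd : IsDoubleZero P.s11 z) :
    P.AMinus z = -conj (P.APlus (conj z)) := by
  rw [AMinus, APlus, iteratedDeriv_s22_conj hz, bPlus_conj hz hd]
  simp [map_ofNat, neg_div]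

theorem BMinus_eq_conj {z : ℂ} (hz : z ∈ P.DMinus) (hd : IsDoubleZero P.s11 z) :
    P.BMinus z = conj (P.BPlus (conj z)) := by
  rw [BMinus, BPlus, iteratedDeriv_s22_conj hz, iteratedDeriv_s22_conj hz, bPlus_conj hz hd,
    dPlus_conj hz hd]
  simp [map_ofNat, neg_div_neg_eq]

/-! ### Symmetry under `z ↦ -q₀²/z` -/

theorem psiPlus_zero_hat {z : ℂ} (hz : z ∈ P.DMinus) (x t : ℝ) :
    P.psiPlus 0 x t z = (-(I * conj P.qPlus / z)) • P.psiPlus 1 x t (P.hat z) :=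
  congrFun (congrFun (P.jostRegular_plus_zero.2 _ hz _ _ (isJost_psiPlus_zero hz)
    ((isJost_psiPlus_one (hat_mem_DPlus hz)).of_hat_one (ne_zero_of_mem_DMinus hz)
      P.qPlus_mul_conj)) x) t

theorem psiMinus_one_hat {z : ℂ} (hz : z ∈ P.DMinus) (x t : ℝ) :
    P.psiMinus 1 x t z = (-(I * P.qMinus / z)) • P.psiMinus 0 x t (P.hat z) :=
  congrFun (congrFun (P.jostRegular_minus_one.2 _ hz _ _ (isJost_psiMinus_one hz)
    ((isJost_psiMinus_zero (hat_mem_DPlus hz)).of_hat_zero (ne_zero_of_mem_DMinus hz)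
      P.qMinus_mul_conj)) x) t

theorem s11_hat {z : ℂ} (hz : z ∈ P.DMinus) :
    P.s11 z = P.qMinus / P.qPlus * P.s22 (P.hat z) := by
  have hz0 := ne_zero_of_mem_DMinus hz
  have hq := P.q₀_ne_zero
  have hp := P.qPlus_ne_zero
  have hg := gam_ne_zero_of_mem_DMinus hz
  rw [s11, s22, gam_hat hz0, psiPlus_zero_hat hz, psiMinus_one_hat hz]
  simp only [Wr, Pi.smul_apply, smul_eq_mul]
  field_simp
  have h := P.qPlus_mul_conj
  rw [I_sq, ← h]
  ring

theorem s11_eventuallyEq {z : ℂ} (hz : z ∈ P.DMinus) :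
    P.s11 =ᶠ[𝓝 z] fun w => P.qMinus / P.qPlus * (P.s22 ∘ P.hat) w := by
  filter_upwards [P.isOpen_DMinus.mem_nhds hz] with w hw using s11_hat hw

theorem contDiffAt_hat {z : ℂ} (hz : z ≠ 0) (n : WithTop ℕ∞) : ContDiffAt ℂ n P.hat z :=
  contDiffAt_const.div contDiffAt_id hz

theorem iteratedDeriv_two_hat {z : ℂ} (hz : z ≠ 0) :
    iteratedDeriv 2 P.hat z = -2 * (P.q₀ : ℂ) ^ 2 / z ^ 3 := by
  rw [iteratedDeriv_succ, iteratedDeriv_one]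
  have h : deriv P.hat =ᶠ[𝓝 z] fun w => (P.q₀ : ℂ) ^ 2 / w ^ 2 := by
    filter_upwards [isOpen_ne.mem_nhds hz] with w hw using (hasDerivAt_hat hw).deriv
  rw [h.deriv_eq]
  have := (hasDerivAt_const z ((P.q₀ : ℂ) ^ 2)).div (hasDerivAt_pow 2 z) (pow_ne_zero 2 hz)
  refine this.deriv.trans ?_
  field_simp
  ring

theorem deriv_s11_hat {z : ℂ} (hz : z ∈ P.DMinus) :
    deriv P.s11 z = P.qMinus / P.qPlus *
      (deriv P.s22 (P.hat z) * ((P.q₀ : ℂ) ^ 2 / z ^ 2)) := by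
  rw [(s11_eventuallyEq hz).deriv_eq]
  exact (((differentiableAt_s22 (hat_mem_DPlus hz)).hasDerivAt.comp z
    (hasDerivAt_hat (ne_zero_of_mem_DMinus hz))).const_mul _).deriv

theorem iteratedDeriv_two_s11_hat {z : ℂ} (hz : z ∈ P.DMinus) (h : deriv P.s22 (P.hat z) = 0) :
    iteratedDeriv 2 P.s11 z = P.qMinus / P.qPlus *
      (iteratedDeriv 2 P.s22 (P.hat z) * ((P.q₀ : ℂ) ^ 2 / z ^ 2) ^ 2) := by
  have hz0 := ne_zero_of_mem_DMinus hz
  have ha := analyticAt_s22 (hat_mem_DPlus hz)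
  rw [(s11_eventuallyEq hz).iteratedDeriv_eq, iteratedDeriv_const_mul_field,
    iteratedDeriv_comp_two ha.contDiffAt (contDiffAt_hat hz0 2), h, (hasDerivAt_hat hz0).deriv]
  ring

/-- With `s₂₂' = 0` two terms of the third-order chain rule survive. Divided by `3 s₁₁''`, the
second of them is `g''/g' = -2/z` for `g = hat`, the origin of `2/z` in `BMinus_hat`. -/
theorem iteratedDeriv_three_s11_hat {z : ℂ} (hz : z ∈ P.DMinus) (h : deriv P.s22 (P.hat z) = 0) :
    iteratedDeriv 3 P.s11 z = P.qMinus / P.qPlus *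
      (iteratedDeriv 3 P.s22 (P.hat z) * ((P.q₀ : ℂ) ^ 2 / z ^ 2) ^ 3 +
        3 * iteratedDeriv 2 P.s22 (P.hat z) * (-2 * (P.q₀ : ℂ) ^ 2 / z ^ 3) *
          ((P.q₀ : ℂ) ^ 2 / z ^ 2)) := by
  have hz0 := ne_zero_of_mem_DMinus hz
  have ha := analyticAt_s22 (hat_mem_DPlus hz)
  rw [(s11_eventuallyEq hz).iteratedDeriv_eq, iteratedDeriv_const_mul_field,
    iteratedDeriv_comp_three ha.contDiffAt (contDiffAt_hat hz0 3), h, (hasDerivAt_hat hz0).deriv,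
    iteratedDeriv_two_hat hz0]
  ring

theorem isDoubleZero_hat {z : ℂ} (hz : z ∈ P.DMinus) (hd : IsDoubleZero P.s11 z) :
    IsDoubleZero P.s22 (P.hat z) := by
  obtain ⟨h0, h1, h2⟩ := hd
  have hz0 := ne_zero_of_mem_DMinus hz
  have hc : P.qMinus / P.qPlus ≠ 0 := div_ne_zero P.qMinus_ne_zero P.qPlus_ne_zero
  have hu : (P.q₀ : ℂ) ^ 2 / z ^ 2 ≠ 0 := div_ne_zero (pow_ne_zero 2 P.q₀_ne_zero) (pow_ne_zero 2 hz0)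
  have h1' : deriv P.s22 (P.hat z) = 0 := by
    rw [deriv_s11_hat hz] at h1
    simpa [hc, hu, P.q₀_ne_zero, P.qPlus_ne_zero, P.qMinus_ne_zero, hz0] using h1
  refine ⟨?_, h1', fun h => h2 ?_⟩
  · rw [s11_hat hz] at h0
    exact (mul_eq_zero.1 h0).resolve_left hc
  · rw [iteratedDeriv_two_s11_hat hz h1', h]
    ring

theorem hasDerivAt_smul_comp_hat {f g : ℂ → Fin 2 → ℂ} {c z : ℂ} (hz : z ≠ 0)
    (hg : DifferentiableAt ℂ g (P.hat z)) (h : ∀ᶠ w in 𝓝 z, f w = (-(I * c / w)) • g (P.hat w)) :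
    deriv f z = (-(I * c / z)) • (((P.q₀ : ℂ) ^ 2 / z ^ 2) • deriv g (P.hat z) - z⁻¹ • g (P.hat z)) := by
  have h1 : HasDerivAt (fun w => -(I * c / w)) (I * c / z ^ 2) z := by
    have := (((hasDerivAt_inv hz).const_mul (I * c)).neg)
    convert! this using 1
    field_simp
  have h2 := hg.hasDerivAt.scomp z (hasDerivAt_hat hz)
  refine ((h1.smul h2).congr_of_eventuallyEq h).deriv.trans ?_
  simp only [Function.comp_apply, smul_sub, smul_smul]
  rw [sub_eq_add_neg, ← neg_smul]
  congr 2
  field_simp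

theorem psiPlus'_zero_hat {z : ℂ} (hz : z ∈ P.DMinus) (x t : ℝ) :
    P.psiPlus' 0 x t z = (-(I * conj P.qPlus / z)) • (((P.q₀ : ℂ) ^ 2 / z ^ 2) •
      P.psiPlus' 1 x t (P.hat z) - z⁻¹ • P.psiPlus 1 x t (P.hat z)) :=
  hasDerivAt_smul_comp_hat (ne_zero_of_mem_DMinus hz)
    (differentiableAt_psiPlus_one (hat_mem_DPlus hz) x t)
    (by filter_upwards [P.isOpen_DMinus.mem_nhds hz] with w hw using psiPlus_zero_hat hw x t)

theorem psiMinus'_one_hat {z : ℂ} (hz : z ∈ P.DMinus) (x t : ℝ) :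
    P.psiMinus' 1 x t z = (-(I * P.qMinus / z)) • (((P.q₀ : ℂ) ^ 2 / z ^ 2) •
      P.psiMinus' 0 x t (P.hat z) - z⁻¹ • P.psiMinus 0 x t (P.hat z)) :=
  hasDerivAt_smul_comp_hat (ne_zero_of_mem_DMinus hz)
    (differentiableAt_psiMinus_zero (hat_mem_DPlus hz) x t)
    (by filter_upwards [P.isOpen_DMinus.mem_nhds hz] with w hw using psiMinus_one_hat hw x t)

theorem bMinus_hat {z : ℂ} (hz : z ∈ P.DMinus) (hd : IsDoubleZero P.s11 z) :
    P.bMinus z = conj P.qPlus / P.qMinus * P.bPlus (P.hat z) := by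
  have hm := P.qMinus_ne_zero
  refine bMinus_eq hz fun x t => ?_
  rw [psiPlus_zero_hat hz, psiMinus_one_hat hz,
    ((plus_relations (hat_mem_DPlus hz) (isDoubleZero_hat hz hd)).2 x t).1, smul_smul, smul_smul]
  congr 1
  field_simp

/-- The `-z⁻¹` terms, from differentiating the scalar prefactors, match on both sides of the
relation because the undifferentiated columns are proportional. Only the chain-rule factor `q₀²/z²`
is left. -/
theorem dMinus_hat {z : ℂ} (hz : z ∈ P.DMinus) (hd : IsDoubleZero P.s11 z) :
    P.dMinus z = conj P.qPlus / P.qMinus * ((P.q₀ : ℂ) ^ 2 / z ^ 2) * P.dPlus (P.hat z) := by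
  have hm := P.qMinus_ne_zero
  refine dMinus_eq hz fun x t => ?_
  obtain ⟨h1, h2⟩ := (plus_relations (hat_mem_DPlus hz) (isDoubleZero_hat hz hd)).2 x t
  rw [bMinus_hat hz hd, psiPlus'_zero_hat hz, psiMinus'_one_hat hz, psiMinus_one_hat hz, h2, h1]
  have e : conj P.qPlus = conj P.qPlus / P.qMinus * P.qMinus := by field_simp
  rw [e]
  generalize conj P.qPlus / P.qMinus = r
  ext i
  simp only [Pi.smul_apply, Pi.add_apply, Pi.sub_apply, smul_eq_mul]
  field_simp
  ring

/-- The boundary values enter as `q_+ q_+^*/q_-²`, which equals `q_-^*/q_-` because `|q_+| = |q_-|`.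
-/
theorem AMinus_hat {z : ℂ} (hz : z ∈ P.DMinus) (hd : IsDoubleZero P.s11 z) :
    P.AMinus z = z ^ 4 * conj P.qMinus / ((P.q₀ : ℂ) ^ 4 * P.qMinus) * P.APlus (P.hat z) := by
  have hz0 := ne_zero_of_mem_DMinus hz
  have hq := P.q₀_ne_zero
  have hp := P.qPlus_ne_zero
  have hm := P.qMinus_ne_zero
  have hd' := isDoubleZero_hat hz hd
  have h2 := hd'.2.2
  rw [AMinus, APlus, iteratedDeriv_two_s11_hat hz hd'.2.1, bMinus_hat hz hd]
  field_simp
  linear_combination P.bPlus (P.hat z) * (P.qPlus_mul_conj - P.qMinus_mul_conj)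

theorem BMinus_hat {z : ℂ} (hz : z ∈ P.DMinus) (hd : IsDoubleZero P.s11 z) :
    P.BMinus z = (P.q₀ : ℂ) ^ 2 / z ^ 2 * P.BPlus (P.hat z) + 2 / z := by
  have hz0 := ne_zero_of_mem_DMinus hz
  have hq := P.q₀_ne_zero
  have hp := P.qPlus_ne_zero
  have hpc : conj P.qPlus ≠ 0 := by simpa using hp
  have hm := P.qMinus_ne_zero
  have hd' := isDoubleZero_hat hz hd
  have h2 := hd'.2.2
  have hb := (plus_relations (hat_mem_DPlus hz) hd').1
  rw [BMinus, BPlus, iteratedDeriv_two_s11_hat hz hd'.2.1, iteratedDeriv_three_s11_hat hz hd'.2.1,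
    bMinus_hat hz hd, dMinus_hat hz hd]
  field_simp
  ring

end NZBCPotential

end KunduEckhaus

open KunduEckhaus.NZBCPotential in
theorem proposition4p2 (P : KunduEckhaus.NZBCPotential) :
    -- linear relations at the double zeros of `s₁₁` in `D⁻`
    (∀ z ∈ P.DMinus, KunduEckhaus.NZBCPotential.IsDoubleZero P.s11 z →
      AnalyticAt ℂ P.s11 z ∧ P.bMinus z ≠ 0 ∧
      ∀ x t : ℝ,
        DifferentiableAt ℂ (fun w => P.psiPlus 0 x t w) z ∧
        DifferentiableAt ℂ (fun w => P.psiMinus 1 x t w) z ∧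
        P.psiPlus 0 x t z = P.bMinus z • P.psiMinus 1 x t z ∧
        P.psiPlus' 0 x t z
          = P.dMinus z • P.psiMinus 1 x t z + P.bMinus z • P.psiMinus' 1 x t z) ∧
    -- linear relations at the double zeros of `s₂₂` in `D⁺`
    (∀ z ∈ P.DPlus, KunduEckhaus.NZBCPotential.IsDoubleZero P.s22 z →
      AnalyticAt ℂ P.s22 z ∧ P.bPlus z ≠ 0 ∧
      ∀ x t : ℝ,
        DifferentiableAt ℂ (fun w => P.psiPlus 1 x t w) z ∧
        DifferentiableAt ℂ (fun w => P.psiMinus 0 x t w) z ∧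
        P.psiPlus 1 x t z = P.bPlus z • P.psiMinus 0 x t z ∧
        P.psiPlus' 1 x t z
          = P.dPlus z • P.psiMinus 0 x t z + P.bPlus z • P.psiMinus' 0 x t z) ∧
    -- symmetries of the norming data
    (∀ z ∈ P.DMinus, KunduEckhaus.NZBCPotential.IsDoubleZero P.s11 z →
      (conj z ∈ P.DPlus ∧ KunduEckhaus.NZBCPotential.IsDoubleZero P.s22 (conj z)) ∧
      (-(P.q₀ : ℂ) ^ 2 / z ∈ P.DPlus ∧
        KunduEckhaus.NZBCPotential.IsDoubleZero P.s22 (-(P.q₀ : ℂ) ^ 2 / z)) ∧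
      (-(P.q₀ : ℂ) ^ 2 / conj z ∈ P.DMinus ∧
        KunduEckhaus.NZBCPotential.IsDoubleZero P.s11 (-(P.q₀ : ℂ) ^ 2 / conj z)) ∧
      P.AMinus z = -conj (P.APlus (conj z)) ∧
      P.AMinus z = z ^ 4 * conj P.qMinus / ((P.q₀ : ℂ) ^ 4 * P.qMinus)
        * P.APlus (-(P.q₀ : ℂ) ^ 2 / z) ∧
      P.AMinus z = -(z ^ 4 * conj P.qMinus / ((P.q₀ : ℂ) ^ 4 * P.qMinus)
        * conj (P.AMinus (-(P.q₀ : ℂ) ^ 2 / conj z))) ∧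
      P.BMinus z = conj (P.BPlus (conj z)) ∧
      P.BMinus z = (P.q₀ : ℂ) ^ 2 / z ^ 2 * P.BPlus (-(P.q₀ : ℂ) ^ 2 / z) + 2 / z ∧
      P.BMinus z = (P.q₀ : ℂ) ^ 2 / z ^ 2 * conj (P.BMinus (-(P.q₀ : ℂ) ^ 2 / conj z))
        + 2 / z) := by
  refine ⟨fun z hz hd => ?_, fun z hz hd => ?_, fun z hz hd => ?_⟩
  · obtain ⟨hb, h⟩ := minus_relations hz hd
    exact ⟨analyticAt_s11 hz, hb, fun x t => ⟨differentiableAt_psiPlus_zero hz x t,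
      differentiableAt_psiMinus_one hz x t, (h x t).1, (h x t).2⟩⟩
  · obtain ⟨hb, h⟩ := plus_relations hz hd
    exact ⟨analyticAt_s22 hz, hb, fun x t => ⟨differentiableAt_psiPlus_one hz x t,
      differentiableAt_psiMinus_zero hz x t, (h x t).1, (h x t).2⟩⟩
  · have hh := hat_mem_DPlus hz
    have hdh := isDoubleZero_hat hz hd
    have hc := conj_mem_DMinus hh
    have hdc : IsDoubleZero P.s11 (conj (P.hat z)) :=
      isDoubleZero_of_conj hc (by rwa [conj_conj])
    have e : -(P.q₀ : ℂ) ^ 2 / conj z = conj (P.hat z) := by simp [hat, neg_div]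
    -- The conjugation symmetry at `-q₀²/z*`, whose conjugate is `-q₀²/z`, turns the second equality
    -- of each chain into the third.
    have hA := AMinus_eq_conj hc hdc
    have hB := BMinus_eq_conj hc hdc
    rw [conj_conj] at hA hB
    have hA' := AMinus_hat hz hd
    have hB' := BMinus_hat hz hd
    rw [e, hA, hB, map_neg, conj_conj, conj_conj]
    exact ⟨⟨conj_mem_DPlus hz, isDoubleZero_conj hz hd⟩, ⟨hh, hdh⟩, ⟨hc, hdc⟩,
      AMinus_eq_conj hz hd, hA', by rw [hA', mul_neg, neg_neg], BMinus_eq_conj hz hd, hB', hB'⟩
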